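/- Let $L>0$, $\omega_0>0$, $\alpha\ge 0$ and $f\in C^2(\mathbb R)$. For each sufficiently large integer $N$ let $x^{(N)}_k(t)$, $k\in\mathbb Z$, $t\ge 0$, be a solution of $$\ddot x_k=\omega^2(x_{k+1}-2x_k+x_{k-1})-\alpha\dot x_k+f(t),\qquad \omega=\omega_0N,\qquad x_{k+N}(t)=x_k(t)+L,$$ with $0=x^{(N)}_0(0)<x^{(N)}_1(0)<\dots<x^{(N)}_N(0)=L$, and suppose that the initial velocities $\dot x_0^{(N)}(0)$ converge to some $v\in\mathbb R$ as $N\to\infty$ (for example, they do not depend on $N$). Assume that there are $L$-periodic functions $X,V\in C^4(\mathbb R)$, with $X>0$, $\int_0^LX(u)\,du=L$ and $\int_0^LV(u)\,du=0$, and constants $C_1,C_2>0$, such that for all sufficiently large $N$ and all $k$ $$\Big|x^{(N)}_{k+1}(0)-x^{(N)}_k(0)-\tfrac LN X\big(\tfrac{kL}N\big)\Big|<\frac{C_1}{N^2},\qquad \Big|\dot x^{(N)}_{k+1}(0)-\dot x^{(N)}_k(0)-\tfrac LN V\big(\tfrac{kL}N\big)\Big|<\frac{C_2}{N^2}.$$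 Put $c_1=L\int_0^L|X''(u)|\,du$, $c_2=L\int_0^L|V''(u)|\,du$ and assume that for some $0<\delta<1$ $$\gamma=\Big(1+\frac{\alpha}{8\omega_0}\Big)\Big(2c_1+\frac{C_1}{L}\Big)+\frac{2c_2+C_2/L}{4\omega_0}<\delta .$$ For $x\in\mathbb R$ let $k(x,N)$ be the integer with $x^{(N)}_{k(x,N)}(0)\le x<x^{(N)}_{k(x,N)+1}(0)$ (it exists and is unique for all sufficiently large $N$). Then there is a function $Y:[0,\infty)\times\mathbb R\to\mathbb R$ such that: 1) for every $T>0$, $\lim_{N\to\infty}x^{(N)}_{k(x,N)}(t)=Y(t,x)$ uniformly in $t\in[0,T]$ and $x\in\mathbb R$, and $Y(t,x+L)=Y(t,x)+L$ for all $t\ge0$, $x\in\mathbb R$; 2) $Y$ is differentiable in $(t,x)$ on $[0,\infty)\times\mathbb R$ (one-sidedly in $t$ at $t=0$), and for each $t\ge 0$ the function $Y(t,\cdot)$ is strictly increasing and is a $C^1$ diffeomorphism of $\mathbb R$ onto itself. -/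

import Mathlib

open Set Filter Topology
open scoped Manifold

/-- `ξ : ℤ → ℝ` is an ordered configuration with `N` particles per period `L`:
`ξ (k + N) = ξ k + L` and `0 = ξ 0 < ξ 1 < ⋯ < ξ N = L`. -/
structure IsOrderedConfiguration (N : ℕ) (L : ℝ) (ξ : ℤ → ℝ) : Prop where
  periodic : ∀ k : ℤ, ξ (k + N) = ξ k + L
  zero : ξ 0 = 0
  strictMono : StrictMono ξ

/-- `x k t` (position of the particle `k` at time `t`) and `v k t` (its velocity) form an
`L`-periodic solution on the time interval `[0, ∞)` of the oscillator chain
`x_k'' = ω² (x_{k+1} - 2 x_k + x_{k-1}) - α x_k' + f(t)`, with `x_{k+N} = x_k + L`. -/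
structure IsChainSolution (N : ℕ) (L ω α : ℝ) (f : ℝ → ℝ) (x v : ℤ → ℝ → ℝ) : Prop where
  periodic : ∀ (k : ℤ) (t : ℝ), 0 ≤ t → x (k + N) t = x k t + L
  velocity : ∀ (k : ℤ) (t : ℝ), 0 ≤ t → HasDerivWithinAt (x k) (v k t) (Ici 0) t
  newton : ∀ (k : ℤ) (t : ℝ), 0 ≤ t →
    HasDerivWithinAt (v k)
      (ω ^ 2 * (x (k + 1) t - 2 * x k t + x (k - 1) t) - α * v k t + f t) (Ici 0) t

/-- `X` and `V` are admissible profiles of the initial gaps and of the initial velocity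
differences: `L`-periodic of class `C⁴`, `X > 0`, with `∫₀ᴸ X = L` and `∫₀ᴸ V = 0`. -/
structure IsProfile (L : ℝ) (X V : ℝ → ℝ) : Prop where
  contDiff_X : ContDiff ℝ 4 X
  contDiff_V : ContDiff ℝ 4 V
  periodic_X : Function.Periodic X L
  periodic_V : Function.Periodic V L
  pos_X : ∀ u, 0 < X u
  integral_X : ∫ u in (0 : ℝ)..L, X u = L
  integral_V : ∫ u in (0 : ℝ)..L, V u = 0

/-- Initial positions `ξ` and initial velocities `η` of the `N`-particle system follow the
profiles `X`, `V` up to errors `C₁ / N²` and `C₂ / N²`, uniformly in `k`. -/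
structure FollowsProfile (N : ℕ) (L : ℝ) (X V : ℝ → ℝ) (C₁ C₂ : ℝ) (ξ η : ℤ → ℝ) : Prop where
  position : ∀ k : ℤ, |ξ (k + 1) - ξ k - L / N * X (k * L / N)| < C₁ / (N : ℝ) ^ 2
  velocity : ∀ k : ℤ, |η (k + 1) - η k - L / N * V (k * L / N)| < C₂ / (N : ℝ) ^ 2

/-- The fluctuation `L ∫₀ᴸ |g''(u)| du` of a profile `g`. -/
noncomputable def fluctuation (L : ℝ) (g : ℝ → ℝ) : ℝ :=
  L * ∫ u in (0 : ℝ)..L, |iteratedDeriv 2 g u|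

/-- The constant
`γ = (1 + α / (8 ω₀)) (2 c₁ + C₁ / L) + (2 c₂ + C₂ / L) / (4 ω₀)`,
where `c₁` and `c₂` are the fluctuations of `X` and `V`. -/
noncomputable def gammaConst (L ω₀ α : ℝ) (X V : ℝ → ℝ) (C₁ C₂ : ℝ) : ℝ :=
  (1 + α / (8 * ω₀)) * (2 * fluctuation L X + C₁ / L)
    + (2 * fluctuation L V + C₂ / L) / (4 * ω₀)

/-- The index `k` of the particle with `ξ k ≤ x < ξ (k + 1)`. -/
noncomputable def particleIndex (ξ : ℤ → ℝ) (x : ℝ) : ℤ := sSup {k : ℤ | ξ k ≤ x}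

/-- For an ordered periodic configuration `particleIndex ξ x` is the only integer `k` with
`ξ k ≤ x < ξ (k + 1)`. -/
theorem particleIndex_eq_iff {N : ℕ} {L : ℝ} (hL : 0 < L) {ξ : ℤ → ℝ}
    (h : IsOrderedConfiguration N L ξ) (x : ℝ) (k : ℤ) :
    particleIndex ξ x = k ↔ ξ k ≤ x ∧ x < ξ (k + 1) := by
  have hmul : ∀ m : ℤ, ξ (m * N) = m * L := by
    intro m
    induction m using Int.induction_on with
    | zero => simpa using h.zero
    | succ i ih =>
      have e : ((i : ℤ) + 1) * N = i * N + N := by ring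
      rw [e, h.periodic, ih]; push_cast; ring
    | pred i ih =>
      have e := h.periodic ((-(i : ℤ) - 1) * N)
      have e' : (-(i : ℤ) - 1) * N + N = -i * N := by ring
      rw [e', ih] at e
      push_cast at e ⊢
      linarith
  have hne : {j : ℤ | ξ j ≤ x}.Nonempty := by
    refine ⟨⌊x / L⌋ * N, ?_⟩
    rw [mem_ofPred_eq, hmul, ← le_div_iff₀ hL]
    exact Int.floor_le _
  have hbdd : BddAbove {j : ℤ | ξ j ≤ x} := by
    refine ⟨(⌊x / L⌋ + 1) * N, fun j hj => ?_⟩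
    have h2 : x < ξ ((⌊x / L⌋ + 1) * N) := by
      rw [hmul, ← div_lt_iff₀ hL]
      push_cast
      exact Int.lt_floor_add_one _
    exact (h.strictMono.lt_iff_lt.1 (lt_of_le_of_lt hj h2)).le
  have hmem : ξ (particleIndex ξ x) ≤ x := Int.csSup_mem hne hbdd
  have hle : ∀ j, ξ j ≤ x → j ≤ particleIndex ξ x := fun j hj => le_csSup hbdd hj
  constructor
  · rintro rfl
    refine ⟨hmem, not_le.1 fun hc => ?_⟩
    have := hle _ hc
    omega
  · rintro ⟨h1, h2⟩
    have h3 := hle _ h1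
    have h4 := h.strictMono.lt_iff_lt.1 (lt_of_le_of_lt hmem h2)
    omega

theorem exists_damped_mode (α μ : ℝ) (p w : ℂ) : ∃ g g' : ℝ → ℂ,
    (∀ t, HasDerivAt g (g' t) t) ∧ (∀ t, HasDerivAt g' (-(α * g' t) - μ * g t) t) ∧
    g 0 = p ∧ g' 0 = w := by
  obtain ⟨s, hs⟩ := IsAlgClosed.exists_pow_nat_eq ((α : ℂ) ^ 2 / 4 - μ) (n := 2) (by norm_num)
  have hE : ∀ t : ℝ, HasDerivAt (fun t : ℝ => Complex.exp (-α / 2 * t))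
      (Complex.exp (-α / 2 * t) * (-α / 2)) t := fun t => by
    simpa using ((Complex.ofRealCLM.hasDerivAt (x := t)).const_mul (-α / 2 : ℂ)).cexp
  by_cases h0 : s = 0
  · have hμ : (μ : ℂ) = (α : ℂ) ^ 2 / 4 := by
      rw [h0] at hs
      linear_combination hs
    have hT : ∀ (t : ℝ) (b c : ℂ), HasDerivAt (fun t : ℝ => b + c * t) c t := fun t b c => by
      simpa using ((Complex.ofRealCLM.hasDerivAt (x := t)).const_mul c).const_add b
    refine ⟨fun t => Complex.exp (-α / 2 * t) * (p + (w + α / 2 * p) * t),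
      fun t => Complex.exp (-α / 2 * t) * (w + (-α / 2 * (w + α / 2 * p)) * t),
      fun t => ((hE t).mul (hT t _ _)).congr_deriv ?_,
      fun t => ((hE t).mul (hT t _ _)).congr_deriv ?_, by simp, by simp⟩
    · ring
    · rw [hμ]; ring
  · have hC : ∀ t : ℝ, HasDerivAt (fun t : ℝ => Complex.cosh (s * t))
        (Complex.sinh (s * t) * s) t := fun t => by
      simpa [Function.comp_def] using (Complex.hasDerivAt_cosh (s * t)).comp t
        ((Complex.ofRealCLM.hasDerivAt (x := t)).const_mul s)
    have hS : ∀ t : ℝ, HasDerivAt (fun t : ℝ => Complex.sinh (s * t))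
        (Complex.cosh (s * t) * s) t := fun t => by
      simpa [Function.comp_def] using (Complex.hasDerivAt_sinh (s * t)).comp t
        ((Complex.ofRealCLM.hasDerivAt (x := t)).const_mul s)
    have hD : ∀ (t : ℝ) (b c : ℂ), HasDerivAt (fun t : ℝ => Complex.exp (-α / 2 * t) *
        (b * Complex.cosh (s * t) + c * Complex.sinh (s * t)))
        (Complex.exp (-α / 2 * t) * ((-α / 2 * b + c * s) * Complex.cosh (s * t)
          + (-α / 2 * c + b * s) * Complex.sinh (s * t))) t := fun t b c =>
      ((hE t).mul (((hC t).const_mul b).add ((hS t).const_mul c))).congr_deriv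
        (by simp only [Pi.add_apply]; ring)
    have hμ : (μ : ℂ) = (α : ℂ) ^ 2 / 4 - s ^ 2 := by rw [hs]; ring
    refine ⟨_, _, fun t => hD t p ((w + α / 2 * p) / s),
      fun t => (hD t _ _).congr_deriv ?_, by simp, ?_⟩
    · rw [hμ]; field_simp; ring
    · simp; field_simp; ring

theorem damped_mode_energy {α μ : ℝ} (hα : 0 ≤ α) (hμ : 0 ≤ μ) {g g' : ℝ → ℂ}
    (hg : ∀ t, HasDerivAt g (g' t) t) (hg' : ∀ t, HasDerivAt g' (-(α * g' t) - μ * g t) t) :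
    (∀ t, 0 ≤ t → ‖g' t‖ ^ 2 + μ * ‖g t‖ ^ 2 ≤ ‖g' 0‖ ^ 2 + μ * ‖g 0‖ ^ 2) ∧
    (∀ t, -1 ≤ t → ‖g' t‖ ^ 2 + μ * ‖g t‖ ^ 2 ≤
      Real.exp α ^ 2 * (‖g' 0‖ ^ 2 + μ * ‖g 0‖ ^ 2)) := by
  set e : ℝ → ℝ := fun t => ‖g' t‖ ^ 2 + μ * ‖g t‖ ^ 2 with he
  have hed : ∀ t, HasDerivAt e (-(2 * α * ‖g' t‖ ^ 2)) t := fun t => by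
    refine ((hg' t).norm_sq.add ((hg t).norm_sq.const_mul μ)).congr_deriv ?_
    simp only [Complex.inner, Complex.sq_norm, Complex.normSq_apply, Complex.mul_re,
      Complex.sub_re, Complex.neg_re, Complex.ofReal_re, Complex.ofReal_im, Complex.conj_re,
      Complex.conj_im, Complex.sub_im, Complex.neg_im, Complex.mul_im]
    ring
  have hanti : Antitone e := antitone_of_hasDerivAt_nonpos hed fun t => by
    have : 0 ≤ 2 * α * ‖g' t‖ ^ 2 := by positivity
    simpa using this
  have hexp : ∀ t : ℝ, HasDerivAt (fun t => Real.exp (2 * α * t))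
      (Real.exp (2 * α * t) * (2 * α)) t := fun t => by
    simpa using ((hasDerivAt_id t).const_mul (2 * α)).exp
  have hmono : Monotone (fun t => Real.exp (2 * α * t) * e t) :=
    monotone_of_hasDerivAt_nonneg (fun t => (hexp t).mul (hed t)) fun t => by
      have : 0 ≤ Real.exp (2 * α * t) * (2 * α * (μ * ‖g t‖ ^ 2)) := by positivity
      simp only [he, Pi.zero_apply]
      nlinarith [this]
  have he0 : ∀ t, 0 ≤ e t := fun t => by positivity
  refine ⟨fun t ht => hanti ht, fun t ht => ?_⟩
  change e t ≤ Real.exp α ^ 2 * e 0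
  rcases le_total 0 t with h | h
  · refine (hanti h).trans (le_mul_of_one_le_left (he0 0) ?_)
    exact one_le_pow₀ (Real.one_le_exp hα)
  · have h1 := hmono h
    simp only [mul_zero, Real.exp_zero, one_mul] at h1
    have h2 : e t = Real.exp (-(2 * α * t)) * (Real.exp (2 * α * t) * e t) := by
      rw [← mul_assoc, ← Real.exp_add]; simp
    have h3 : Real.exp (-(2 * α * t)) ≤ Real.exp α ^ 2 := by
      rw [← Real.exp_nat_mul]
      apply Real.exp_le_exp.2
      push_cast
      nlinarith
    rw [h2]
    exact mul_le_mul h3 h1 (by positivity) (by positivity)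

theorem add_sq_le_of_mode_energy {b C x y p w : ℝ} (hb : 0 < b) (hC : 0 ≤ C)
    (hp : 0 ≤ p) (hw : 0 ≤ w)
    (h : y ^ 2 + b ^ 2 * x ^ 2 ≤ C ^ 2 * (w ^ 2 + b ^ 2 * p ^ 2)) :
    x ≤ C * (p + w / b) ∧ y ≤ C * (w + b * p) := by
  have h1 : w ^ 2 + b ^ 2 * p ^ 2 ≤ (w + b * p) ^ 2 := by
    have : 0 ≤ w * (b * p) := by positivity
    nlinarith
  have h2 : C ^ 2 * (w ^ 2 + b ^ 2 * p ^ 2) ≤ (C * (w + b * p)) ^ 2 := by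
    rw [mul_pow]; gcongr
  have h3 : 0 ≤ C * (w + b * p) := by positivity
  have h4 : y ≤ C * (w + b * p) := abs_le_of_sq_le_sq' (by nlinarith [sq_nonneg (b * x)]) h3 |>.2
  have h5 : b * x ≤ C * (w + b * p) :=
    abs_le_of_sq_le_sq' (by nlinarith [sq_nonneg y]) h3 |>.2
  refine ⟨?_, h4⟩
  have : C * (p + w / b) = C * (w + b * p) / b := by field_simp; ring
  rw [this, le_div_iff₀ hb]
  linarith

/-- Existence of a mode of the damped wave equation with its a priori bounds. -/
theorem exists_damped_mode_bounds {α b : ℝ} (hα : 0 ≤ α) (p w : ℂ)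
    (hb : 0 < b ∨ (p = 0 ∧ w = 0)) : ∃ g g' : ℝ → ℂ,
    (∀ t, HasDerivAt g (g' t) t) ∧
    (∀ t, HasDerivAt g' (-(α * g' t) - (b ^ 2 : ℝ) * g t) t) ∧ g 0 = p ∧ g' 0 = w ∧
    (∀ t, 0 ≤ t → ‖g t‖ ≤ ‖p‖ + ‖w‖ / b) ∧
    (∀ t, -1 ≤ t → ‖g t‖ ≤ Real.exp α * (‖p‖ + ‖w‖ / b)) ∧
    (∀ t, -1 ≤ t → ‖g' t‖ ≤ Real.exp α * (‖w‖ + b * ‖p‖)) := by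
  rcases hb with hb | ⟨rfl, rfl⟩
  · obtain ⟨g, g', h1, h2, h3, h4⟩ := exists_damped_mode α (b ^ 2) p w
    obtain ⟨e1, e2⟩ := damped_mode_energy hα (sq_nonneg b) h1 h2
    rw [h3, h4] at e1 e2
    have k1 : ∀ t : ℝ, 0 ≤ t → _ := fun t ht => add_sq_le_of_mode_energy (C := 1) hb zero_le_one
      (x := ‖g t‖) (y := ‖g' t‖) (norm_nonneg p) (norm_nonneg w)
      (by simpa using e1 t ht)
    have k2 : ∀ t : ℝ, -1 ≤ t → _ := fun t ht => add_sq_le_of_mode_energy hb (Real.exp_pos α).le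
      (x := ‖g t‖) (y := ‖g' t‖) (norm_nonneg p) (norm_nonneg w) (e2 t ht)
    exact ⟨g, g', h1, h2, h3, h4, fun t ht => by simpa using (k1 t ht).1,
      fun t ht => (k2 t ht).1, fun t ht => (k2 t ht).2⟩
  · exact ⟨fun _ => 0, fun _ => 0, fun t => hasDerivAt_const t 0,
      fun t => (hasDerivAt_const t (0 : ℂ)).congr_deriv (by simp), rfl, rfl,
      by simp, by simp, by simp⟩

/-- The `k`-th wave number of the circle of length `L`. -/
noncomputable def waveNumber (L : ℝ) (k : ℤ) : ℝ := 2 * Real.pi * k / L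

/-- The `k`-th plane wave of period `L`. -/
noncomputable def planeWave (L : ℝ) (k : ℤ) (u : ℝ) : ℂ := Complex.exp (waveNumber L k * u * Complex.I)

/-- The `k`-th Fourier coefficient of a function of period `L`. -/
noncomputable def periodCoeff (L : ℝ) (G : ℝ → ℝ) (k : ℤ) : ℂ :=
  (1 / L : ℝ) • ∫ u in (0 : ℝ)..L, planeWave L (-k) u * G u

theorem norm_planeWave (L : ℝ) (k : ℤ) (u : ℝ) : ‖planeWave L k u‖ = 1 := by
  rw [planeWave, ← Complex.ofReal_mul, Complex.norm_exp_ofReal_mul_I]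

theorem waveNumber_neg (L : ℝ) (k : ℤ) : waveNumber L (-k) = -waveNumber L k := by
  simp [waveNumber, neg_div]

theorem hasDerivAt_planeWave (L : ℝ) (k : ℤ) (u : ℝ) :
    HasDerivAt (planeWave L k) (waveNumber L k * Complex.I * planeWave L k u) u := by
  have := (((Complex.ofRealCLM.hasDerivAt (x := u)).const_mul
    (waveNumber L k : ℂ)).mul_const Complex.I).cexp
  refine this.congr_deriv ?_
  simp [planeWave]
  ring

theorem planeWave_add (L : ℝ) (k : ℤ) (u s : ℝ) :
    planeWave L k (u + s) = planeWave L k u * planeWave L k s := by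
  simp only [planeWave, ← Complex.exp_add]
  congr 1; push_cast; ring

theorem planeWave_period {L : ℝ} (hL : 0 < L) (k : ℤ) : planeWave L k L = 1 := by
  rw [planeWave, Complex.exp_eq_one_iff]
  refine ⟨k, ?_⟩
  have : (L : ℂ) ≠ 0 := by exact_mod_cast hL.ne'
  simp only [waveNumber]; push_cast; field_simp

theorem planeWave_eq_fourier (L : ℝ) (k : ℤ) (u : ℝ) :
    fourier k (u : AddCircle L) = planeWave L k u := by
  rw [fourier_coe_apply, planeWave, waveNumber]
  congr 1; push_cast; ring

theorem waveNumber_ne_zero {L : ℝ} (hL : 0 < L) {k : ℤ} (hk : k ≠ 0) : waveNumber L k ≠ 0 := by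
  have : (k : ℝ) ≠ 0 := by exact_mod_cast hk
  have := Real.pi_pos.ne'
  simp only [waveNumber]; positivity

theorem periodCoeff_deriv {L : ℝ} (hL : 0 < L) {G : ℝ → ℝ} (hG : ContDiff ℝ 1 G)
    (hper : Function.Periodic G L) (k : ℤ) :
    periodCoeff L (deriv G) k = waveNumber L k * Complex.I * periodCoeff L G k := by
  have hd : ∀ u, HasDerivAt (fun u => (G u : ℂ)) ((deriv G u : ℝ) : ℂ) u := fun u =>
    ((hG.differentiable one_ne_zero).differentiableAt.hasDerivAt).ofReal_comp
  have hcw : Continuous (planeWave L (-k)) :=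
    continuous_iff_continuousAt.2 fun u => (hasDerivAt_planeWave L (-k) u).continuousAt
  have hcd : Continuous fun u => ((deriv G u : ℝ) : ℂ) :=
    Complex.continuous_ofReal.comp (hG.continuous_deriv le_rfl)
  have := intervalIntegral.integral_mul_deriv_eq_deriv_mul
    (a := 0) (b := L) (fun u _ => hasDerivAt_planeWave L (-k) u) (fun u _ => hd u)
    (Continuous.intervalIntegrable (by fun_prop) _ _) (hcd.intervalIntegrable _ _)
  have h0 : G L = G 0 := by simpa using hper 0
  rw [planeWave_period hL, h0, show planeWave L (-k) 0 = 1 by simp [planeWave]] at this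
  rw [periodCoeff, this, periodCoeff, waveNumber_neg]
  simp only [sub_self, zero_sub, mul_assoc, intervalIntegral.integral_const_mul]
  simp only [Complex.real_smul]
  push_cast
  ring

theorem norm_periodCoeff_le {L : ℝ} (hL : 0 < L) (G : ℝ → ℝ) (k : ℤ) :
    ‖periodCoeff L G k‖ ≤ 1 / L * ∫ u in (0 : ℝ)..L, |G u| := by
  rw [periodCoeff, norm_smul, Real.norm_of_nonneg (by positivity)]
  gcongr
  refine (intervalIntegral.norm_integral_le_integral_norm hL.le).trans_eq ?_
  simp [norm_planeWave]

theorem Function.Periodic.deriv_real {G : ℝ → ℝ} {L : ℝ} (h : Function.Periodic G L) :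
    Function.Periodic (deriv G) L := fun u => by
  rw [← deriv_comp_add_const]
  congr 1
  exact funext h

theorem pow_waveNumber_mul_norm_periodCoeff_le {L : ℝ} (hL : 0 < L) (n : ℕ) {G : ℝ → ℝ}
    (hG : ContDiff ℝ n G) (hper : Function.Periodic G L) (k : ℤ) :
    |waveNumber L k| ^ n * ‖periodCoeff L G k‖ ≤
      1 / L * ∫ u in (0 : ℝ)..L, |iteratedDeriv n G u| := by
  induction n generalizing G with
  | zero => simpa using norm_periodCoeff_le hL G k
  | succ n ih =>
    rw [iteratedDeriv_succ']
    refine le_trans (le_of_eq ?_) (ih (G := deriv G) ?_ hper.deriv_real)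
    · rw [periodCoeff_deriv hL (hG.of_le (by norm_cast; omega)) hper]
      simp; ring
    · exact (contDiff_succ_iff_deriv.1 (by exact_mod_cast hG)).2.2

theorem abs_waveNumber {L : ℝ} (hL : 0 < L) (k : ℤ) :
    |waveNumber L k| = 2 * Real.pi * |(k : ℝ)| / L := by
  rw [waveNumber, abs_div, abs_mul, abs_of_pos hL, abs_of_pos Real.two_pi_pos]

theorem summable_pow_waveNumber_mul_norm_periodCoeff {L : ℝ} (hL : 0 < L) (m : ℕ) {G : ℝ → ℝ}
    (hG : ContDiff ℝ (m + 2 : ℕ) G) (hper : Function.Periodic G L) :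
    Summable fun k : ℤ => |waveNumber L k| ^ m * ‖periodCoeff L G k‖ := by
  set K := 1 / L * ∫ u in (0 : ℝ)..L, |iteratedDeriv (m + 2) G u|
  have h1 : Summable fun k : ℤ => K * (L / (2 * Real.pi)) ^ 2 * (1 / (k : ℝ) ^ 2) :=
    ((Real.summable_one_div_int_pow (p := 2)).2 (by norm_num)).mul_left _
  refine Summable.of_norm_bounded_eventually h1 ?_
  filter_upwards [(Set.finite_singleton (0 : ℤ)).compl_mem_cofinite] with k hk
  have hk0 : 0 < |(k : ℝ)| := abs_pos.2 (by exact_mod_cast hk)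
  have hpos : 0 < |waveNumber L k| := abs_pos.2 (waveNumber_ne_zero hL hk)
  have h2 := pow_waveNumber_mul_norm_periodCoeff_le hL (m + 2) hG hper k
  rw [Real.norm_of_nonneg (by positivity)]
  have h3 : K * (L / (2 * Real.pi)) ^ 2 * (1 / (k : ℝ) ^ 2) = K / |waveNumber L k| ^ 2 := by
    rw [abs_waveNumber hL, ← sq_abs (k : ℝ)]
    have := Real.pi_pos
    field_simp
  rw [h3, le_div_iff₀ (by positivity)]
  calc _ = |waveNumber L k| ^ (m + 2) * ‖periodCoeff L G k‖ := by ring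
    _ ≤ K := h2

/-- Fourier inversion for a smooth periodic function. -/
theorem hasSum_periodCoeff {L : ℝ} (hL : 0 < L) {G : ℝ → ℝ} (hG : ContDiff ℝ 2 G)
    (hper : Function.Periodic G L) (u : ℝ) :
    HasSum (fun k => periodCoeff L G k * planeWave L k u) (G u : ℂ) := by
  have : Fact (0 < L) := ⟨hL⟩
  have hperC : Function.Periodic (fun u => (G u : ℂ)) L := fun u => by simp [hper u]
  have hcont : Continuous hperC.lift := by
    refine continuous_coinduced_dom.2 ?_
    exact Complex.continuous_ofReal.comp hG.continuous
  set F : C(AddCircle L, ℂ) := ⟨hperC.lift, hcont⟩ with hF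
  have hcoef : ∀ k, fourierCoeff F k = periodCoeff L G k := fun k => by
    rw [fourierCoeff_eq_intervalIntegral _ _ 0, periodCoeff, zero_add]
    simp only [planeWave_eq_fourier, smul_eq_mul]
    rfl
  have hsum : Summable (fourierCoeff F) := by
    refine Summable.of_norm ?_
    simpa [hcoef] using summable_pow_waveNumber_mul_norm_periodCoeff hL 0 hG hper
  have := has_pointwise_sum_fourier_series_of_summable hsum (u : AddCircle L)
  simp only [hcoef, planeWave_eq_fourier, smul_eq_mul] at this
  exact this

theorem abs_two_cos_sub_le (θ : ℝ) : |2 * Real.cos θ - 2 + θ ^ 2| ≤ |θ| ^ 3 := by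
  have h1 := Real.one_sub_sq_div_two_le_cos (x := θ)
  rw [abs_of_nonneg (by linarith)]
  rcases le_total |θ| 1 with h | h
  · have h2 := (abs_le.1 (Real.cos_bound h)).2
    have h3 : |θ| ^ 4 ≤ |θ| ^ 3 := pow_le_pow_of_le_one (abs_nonneg _) h (by norm_num)
    have h4 : 0 ≤ |θ| ^ 4 := by positivity
    linarith
  · have h2 := Real.cos_le_one θ
    have h3 : |θ| ^ 2 ≤ |θ| ^ 3 := pow_le_pow_right₀ h (by norm_num)
    rw [sq_abs] at h3
    linarith

theorem norm_planeWave_second_difference (L : ℝ) (k : ℤ) (h : ℝ) :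
    ‖planeWave L k h + planeWave L k (-h) - 2 + waveNumber L k ^ 2 * h ^ 2‖
      ≤ |waveNumber L k| ^ 3 * |h| ^ 3 := by
  have h1 : planeWave L k h + planeWave L k (-h) - 2 + waveNumber L k ^ 2 * h ^ 2
      = ((2 * Real.cos (waveNumber L k * h) - 2 + (waveNumber L k * h) ^ 2 : ℝ) : ℂ) := by
    push_cast
    rw [Complex.two_cos]
    simp only [planeWave]
    push_cast
    ring_nf
  rw [h1, Complex.norm_real, ← mul_pow, ← abs_mul]
  exact abs_two_cos_sub_le _

/-- A family of damped modes on the circle of length `L` with a priori bounds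
that make their superposition a classical solution of the damped wave equation. -/
structure IsModeFamily (L a α : ℝ) (g g' : ℤ → ℝ → ℂ) (B B' : ℤ → ℝ) : Prop where
  deriv_g : ∀ k t, HasDerivAt (g k) (g' k t) t
  deriv_g' : ∀ k t,
    HasDerivAt (g' k) (-(α * g' k t) - ((a * waveNumber L k) ^ 2 : ℝ) * g k t) t
  bound_g : ∀ k t, -1 ≤ t → ‖g k t‖ ≤ B k
  bound_g' : ∀ k t, -1 ≤ t → ‖g' k t‖ ≤ B' k
  summable_B : ∀ m ≤ 3, Summable fun k => |waveNumber L k| ^ m * B k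
  summable_B' : Summable B'

namespace IsModeFamily

variable {L a α : ℝ} {g g' : ℤ → ℝ → ℂ} {B B' : ℤ → ℝ}

theorem summable_B_zero (H : IsModeFamily L a α g g' B B') : Summable B := by
  simpa using H.summable_B 0 (by norm_num)

theorem summable_B_one (H : IsModeFamily L a α g g' B B') :
    Summable fun k => |waveNumber L k| * B k := by
  simpa using H.summable_B 1 (by norm_num)

theorem norm_term (c : ℂ) (k : ℤ) (u : ℝ) : ‖c * planeWave L k u‖ = ‖c‖ := by
  rw [norm_mul, norm_planeWave, mul_one]

theorem summable_term (H : IsModeFamily L a α g g' B B') {t : ℝ} (ht : -1 ≤ t) (u : ℝ) :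
    Summable fun k => g k t * planeWave L k u :=
  .of_norm_bounded H.summable_B_zero fun k => by
    rw [norm_term]; exact H.bound_g k t ht

theorem summable_term' (H : IsModeFamily L a α g g' B B') {t : ℝ} (ht : -1 ≤ t) (u : ℝ) :
    Summable fun k => g' k t * planeWave L k u :=
  .of_norm_bounded H.summable_B' fun k => by
    rw [norm_term]; exact H.bound_g' k t ht

theorem summable_term_sq (H : IsModeFamily L a α g g' B B') {t : ℝ} (ht : -1 ≤ t) (u : ℝ) :
    Summable fun k => -(waveNumber L k ^ 2 : ℂ) * (g k t * planeWave L k u) :=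
  .of_norm_bounded (H.summable_B 2 (by norm_num)) fun k => by
    rw [norm_mul, norm_term, norm_neg, norm_pow, Complex.norm_real, Real.norm_eq_abs]
    exact mul_le_mul_of_nonneg_left (H.bound_g k t ht) (by positivity)

theorem hasDerivAt_time (H : IsModeFamily L a α g g' B B') {t : ℝ} (ht : -1 < t) (u : ℝ) :
    HasDerivAt (fun t => ∑' k, g k t * planeWave L k u) (∑' k, g' k t * planeWave L k u) t :=
  hasDerivAt_tsum_of_isPreconnected H.summable_B' isOpen_Ioi isPreconnected_Ioi
    (fun k t _ => (H.deriv_g k t).mul_const _)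
    (fun k t ht => by rw [norm_term]; exact H.bound_g' k t (le_of_lt ht))
    (show (0 : ℝ) ∈ Ioi (-1 : ℝ) by simp) (H.summable_term (by norm_num) u) ht

theorem hasDerivAt_space (H : IsModeFamily L a α g g' B B') {t : ℝ} (ht : -1 ≤ t) (u : ℝ) :
    HasDerivAt (fun u => ∑' k, g k t * planeWave L k u)
      (∑' k, g k t * (waveNumber L k * Complex.I * planeWave L k u)) u :=
  hasDerivAt_tsum H.summable_B_one
    (fun k u => (hasDerivAt_planeWave L k u).const_mul _)
    (fun k u => by
      rw [← mul_assoc, norm_term]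
      simpa [mul_comm] using mul_le_mul_of_nonneg_right (H.bound_g k t ht) (abs_nonneg _))
    (H.summable_term ht 0) u

theorem continuous_space (H : IsModeFamily L a α g g' B B') {t : ℝ} (ht : -1 ≤ t) :
    Continuous fun u => ∑' k, g k t * (waveNumber L k * Complex.I * planeWave L k u) :=
  continuous_tsum (fun k => by unfold planeWave; fun_prop) H.summable_B_one (fun k u => by
      rw [← mul_assoc, norm_term]
      simpa [mul_comm] using mul_le_mul_of_nonneg_right (H.bound_g k t ht) (abs_nonneg _))

theorem differentiableAt (H : IsModeFamily L a α g g' B B') {t : ℝ} (ht : -1 < t) (u : ℝ) :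
    DifferentiableAt ℝ (fun p : ℝ × ℝ => ∑' k, g k p.1 * planeWave L k p.2) (t, u) := by
  have hd : ∀ k (p : ℝ × ℝ), HasFDerivAt (fun p : ℝ × ℝ => g k p.1 * planeWave L k p.2)
      (g k p.1 • ((ContinuousLinearMap.snd ℝ ℝ ℝ).smulRight
          (waveNumber L k * Complex.I * planeWave L k p.2)) +
        planeWave L k p.2 • ((ContinuousLinearMap.fst ℝ ℝ ℝ).smulRight (g' k p.1))) p :=
    fun k p => by
      have h1 : HasFDerivAt (fun p : ℝ × ℝ => g k p.1)
        ((ContinuousLinearMap.fst ℝ ℝ ℝ).smulRight (g' k p.1)) p := by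
        refine ((H.deriv_g k p.1).hasFDerivAt.comp p hasFDerivAt_fst).congr_fderiv ?_
        ext <;> simp
      have h2 : HasFDerivAt (fun p : ℝ × ℝ => planeWave L k p.2)
        ((ContinuousLinearMap.snd ℝ ℝ ℝ).smulRight
          (waveNumber L k * Complex.I * planeWave L k p.2)) p := by
        refine ((hasDerivAt_planeWave L k p.2).hasFDerivAt.comp p hasFDerivAt_snd).congr_fderiv ?_
        ext <;> simp
      exact h1.mul h2
  refine (hasFDerivAt_tsum_of_isPreconnected (s := Ioi (-1 : ℝ) ×ˢ (univ : Set ℝ))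
    (u := fun k => |waveNumber L k| * B k + B' k) (x₀ := (0, 0))
    (H.summable_B_one.add H.summable_B') (isOpen_Ioi.prod isOpen_univ)
    (isPreconnected_Ioi.prod isPreconnected_univ) (fun k p _ => hd k p) (fun k p hp => ?_)
    (by simp) (H.summable_term (by norm_num) 0) (by simpa using ht)).differentiableAt
  have ht' : -1 ≤ p.1 := le_of_lt hp.1
  refine (norm_add_le _ _).trans (add_le_add ?_ ?_)
  · rw [norm_smul, ContinuousLinearMap.norm_smulRight_apply, norm_term]
    have h1 : ‖ContinuousLinearMap.snd ℝ ℝ ℝ‖ ≤ 1 := ContinuousLinearMap.norm_snd_le ℝ ℝ ℝ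
    calc _ ≤ B k * (1 * |waveNumber L k|) := by
          have := H.bound_g k p.1 ht'
          have h0 := (norm_nonneg _).trans this
          have e : ‖(waveNumber L k : ℂ) * Complex.I‖ = |waveNumber L k| := by simp
          rw [e]
          gcongr
      _ = _ := by ring
  · rw [norm_smul, ContinuousLinearMap.norm_smulRight_apply, norm_planeWave, one_mul]
    have h1 : ‖ContinuousLinearMap.fst ℝ ℝ ℝ‖ ≤ 1 := ContinuousLinearMap.norm_fst_le ℝ ℝ ℝ
    exact (mul_le_mul_of_nonneg_right h1 (norm_nonneg _)).trans
      ((one_mul _).trans_le (H.bound_g' k p.1 ht'))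

theorem hasDerivAt_time_time (H : IsModeFamily L a α g g' B B') (hα : 0 ≤ α) {t : ℝ}
    (ht : -1 < t) (u : ℝ) :
    HasDerivAt (fun t => ∑' k, g' k t * planeWave L k u)
      (a ^ 2 * (∑' k, -(waveNumber L k ^ 2 : ℂ) * (g k t * planeWave L k u))
        - α * ∑' k, g' k t * planeWave L k u) t := by
  have h := hasDerivAt_tsum_of_isPreconnected
    (g := fun k t => g' k t * planeWave L k u)
    (u := fun k => α * B' k + a ^ 2 * (|waveNumber L k| ^ 2 * B k))
    ((H.summable_B'.mul_left α).add ((H.summable_B 2 (by norm_num)).mul_left (a ^ 2)))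
    isOpen_Ioi isPreconnected_Ioi
    (fun k t _ => (H.deriv_g' k t).mul_const _)
    (fun k t ht => ?_)
    (show (0 : ℝ) ∈ Ioi (-1 : ℝ) by simp) (H.summable_term' (by norm_num) u) ht
  · refine h.congr_deriv ?_
    rw [← tsum_mul_left, ← tsum_mul_left, ← Summable.tsum_sub]
    · congr 1; ext k; push_cast; ring
    · exact (H.summable_term_sq ht.le u).mul_left _
    · exact (H.summable_term' ht.le u).mul_left _
  · rw [norm_term]
    have ht' : -1 ≤ t := le_of_lt ht
    refine (norm_sub_le _ _).trans (add_le_add ?_ ?_)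
    · rw [norm_neg, norm_mul, Complex.norm_real, Real.norm_of_nonneg hα]
      exact mul_le_mul_of_nonneg_left (H.bound_g' k t ht') hα
    · rw [norm_mul, Complex.norm_real, Real.norm_of_nonneg (sq_nonneg _), mul_pow, sq_abs,
        ← mul_assoc]
      exact mul_le_mul_of_nonneg_left (H.bound_g k t ht') (by positivity)

theorem second_difference (H : IsModeFamily L a α g g' B B') {t : ℝ} (ht : -1 ≤ t) (u h : ℝ) :
    ‖(∑' k, g k t * planeWave L k (u + h)) - 2 * (∑' k, g k t * planeWave L k u)
      + (∑' k, g k t * planeWave L k (u - h))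
      - h ^ 2 * ∑' k, -(waveNumber L k ^ 2 : ℂ) * (g k t * planeWave L k u)‖
      ≤ |h| ^ 3 * ∑' k, |waveNumber L k| ^ 3 * B k := by
  rw [← tsum_mul_left, ← tsum_mul_left, ← tsum_mul_left,
    ← Summable.tsum_sub (H.summable_term ht _) ((H.summable_term ht _).mul_left _),
    ← Summable.tsum_add
      ((H.summable_term ht _).sub ((H.summable_term ht _).mul_left _)) (H.summable_term ht _),
    ← Summable.tsum_sub
      (((H.summable_term ht _).sub ((H.summable_term ht _).mul_left _)).add
        (H.summable_term ht _)) ((H.summable_term_sq ht u).mul_left _)]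
  refine tsum_of_norm_bounded ((H.summable_B 3 le_rfl).mul_left _).hasSum fun k => ?_
  have e : g k t * planeWave L k (u + h) - 2 * (g k t * planeWave L k u)
      + g k t * planeWave L k (u - h)
      - h ^ 2 * (-(waveNumber L k ^ 2 : ℂ) * (g k t * planeWave L k u))
      = g k t * (planeWave L k h + planeWave L k (-h) - 2 + waveNumber L k ^ 2 * h ^ 2)
        * planeWave L k u := by
    rw [sub_eq_add_neg u h, planeWave_add, planeWave_add]; ring
  rw [e, norm_term, norm_mul]
  have h1 := mul_le_mul (H.bound_g k t ht) (norm_planeWave_second_difference L k h)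
    (norm_nonneg _) ((norm_nonneg _).trans (H.bound_g k t ht))
  linarith

end IsModeFamily

theorem hasSum_int_one_div_sq : HasSum (fun k : ℤ => 1 / (k : ℝ) ^ 2) (Real.pi ^ 2 / 3) := by
  have h := HasSum.of_nat_of_neg (f := fun k : ℤ => 1 / (k : ℝ) ^ 2)
    (by simpa using hasSum_zeta_two) (by simpa using hasSum_zeta_two)
  convert! h using 1
  simp
  ring

theorem inv_abs_waveNumber_le {L : ℝ} (hL : 0 < L) (k : ℤ) : |waveNumber L k|⁻¹ ≤ L := by
  rcases eq_or_ne k 0 with rfl | hk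
  · simpa [waveNumber] using hL.le
  · have h1 : (1 : ℝ) ≤ |(k : ℝ)| := by exact_mod_cast Int.one_le_abs hk
    have h2 := Real.pi_gt_three
    rw [inv_le_comm₀ (abs_pos.2 (waveNumber_ne_zero hL hk)) hL, abs_waveNumber hL,
      ← one_div, div_le_div_iff_of_pos_right hL]
    nlinarith

theorem periodCoeff_zero {L : ℝ} {G : ℝ → ℝ} (h : ∫ u in (0 : ℝ)..L, G u = 0) :
    periodCoeff L G 0 = 0 := by
  simp [periodCoeff, planeWave, waveNumber, intervalIntegral.integral_ofReal, h]

/-- The modes with `|λ|³ ‖c‖ ≤ A` have the summable majorant `A / λ²` for `|λ| ‖c‖`. -/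
theorem waveNumber_mul_le_of_cube_le {L A x : ℝ} (hL : 0 < L) {k : ℤ} (hk : k ≠ 0)
    (h : |waveNumber L k| ^ 3 * x ≤ A) :
    |waveNumber L k| * x ≤ A * (L ^ 2 / (4 * Real.pi ^ 2)) * (1 / (k : ℝ) ^ 2) := by
  have hpos : 0 < |waveNumber L k| := abs_pos.2 (waveNumber_ne_zero hL hk)
  have hk0 : 0 < |(k : ℝ)| := abs_pos.2 (by exact_mod_cast hk)
  have h3 : A * (L ^ 2 / (4 * Real.pi ^ 2)) * (1 / (k : ℝ) ^ 2) = A / |waveNumber L k| ^ 2 := by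
    rw [abs_waveNumber hL, ← sq_abs (k : ℝ)]
    have := Real.pi_pos
    field_simp
    ring
  rw [h3, le_div_iff₀ (by positivity)]
  linarith

theorem exists_isModeFamily {L a α : ℝ} (hL : 0 < L) (ha : 0 < a) (hα : 0 ≤ α) {P W : ℝ → ℝ}
    (hP : ContDiff ℝ 5 P) (hW : ContDiff ℝ 5 W)
    (hPp : Function.Periodic P L) (hWp : Function.Periodic W L)
    (hP0 : ∫ u in (0 : ℝ)..L, P u = 0) (hW0 : ∫ u in (0 : ℝ)..L, W u = 0) :
    ∃ (g g' : ℤ → ℝ → ℂ) (B B' : ℤ → ℝ), IsModeFamily L a α g g' B B' ∧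
      (∀ k, g k 0 = periodCoeff L P k) ∧ (∀ k, g' k 0 = periodCoeff L W k) ∧
      (∀ k t, 0 ≤ t → |waveNumber L k| * ‖g k t‖ ≤
        (L * (∫ u in (0 : ℝ)..L, |iteratedDeriv 3 P u|) +
          L ^ 2 / a * ∫ u in (0 : ℝ)..L, |iteratedDeriv 3 W u|) / (4 * Real.pi ^ 2) *
            (1 / (k : ℝ) ^ 2)) := by
  have hb : ∀ k, 0 < a * |waveNumber L k| ∨ (periodCoeff L P k = 0 ∧ periodCoeff L W k = 0) :=
    fun k => by
      rcases eq_or_ne k 0 with rfl | hk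
      · exact Or.inr ⟨periodCoeff_zero hP0, periodCoeff_zero hW0⟩
      · exact Or.inl (mul_pos ha (abs_pos.2 (waveNumber_ne_zero hL hk)))
  choose g g' h1 h2 h3 h4 h5 h6 h7 using fun k =>
    exists_damped_mode_bounds hα (periodCoeff L P k) (periodCoeff L W k) (hb k)
  have hdiv : ∀ k, ‖periodCoeff L W k‖ / (a * |waveNumber L k|) ≤
      L / a * ‖periodCoeff L W k‖ := fun k => by
    rw [div_eq_mul_inv, mul_inv]
    calc _ ≤ ‖periodCoeff L W k‖ * (a⁻¹ * L) := by
          gcongr; exact inv_abs_waveNumber_le hL k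
      _ = _ := by ring
  have hsP : ∀ m ≤ 3, Summable fun k => |waveNumber L k| ^ m * ‖periodCoeff L P k‖ :=
    fun m hm => summable_pow_waveNumber_mul_norm_periodCoeff hL m
      (hP.of_le (by exact_mod_cast (by omega : m + 2 ≤ 5))) hPp
  have hsW : ∀ m ≤ 3, Summable fun k => |waveNumber L k| ^ m * ‖periodCoeff L W k‖ :=
    fun m hm => summable_pow_waveNumber_mul_norm_periodCoeff hL m
      (hW.of_le (by exact_mod_cast (by omega : m + 2 ≤ 5))) hWp
  refine ⟨g, g', fun k => Real.exp α * (‖periodCoeff L P k‖ + L / a * ‖periodCoeff L W k‖),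
    fun k => Real.exp α * (‖periodCoeff L W k‖ + a * |waveNumber L k| * ‖periodCoeff L P k‖),
    ⟨h1, fun k t => ?_, fun k t ht => (h6 k t ht).trans ?_, h7, fun m hm => ?_, ?_⟩,
    h3, h4, fun k t ht => ?_⟩
  · convert! h2 k t using 4
    rw [mul_pow, mul_pow, sq_abs]
  · gcongr
    exact hdiv k
  · refine (((hsP m hm).add ((hsW m hm).mul_left (L / a))).mul_left (Real.exp α)).congr fun k => ?_
    ring
  · refine ((((hsW 0 (by norm_num))).add
      ((hsP 1 (by norm_num)).mul_left a)).mul_left (Real.exp α)).congr fun k => ?_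
    ring
  · rcases eq_or_ne k 0 with rfl | hk
    · simp [waveNumber]
    · have e1 := pow_waveNumber_mul_norm_periodCoeff_le hL 3 (hP.of_le (by norm_num)) hPp k
      have e2 := pow_waveNumber_mul_norm_periodCoeff_le hL 3 (hW.of_le (by norm_num)) hWp k
      have e3 : |waveNumber L k| ^ 3 * ‖g k t‖ ≤
          1 / L * (∫ u in (0 : ℝ)..L, |iteratedDeriv 3 P u|) +
            L / a * (1 / L * ∫ u in (0 : ℝ)..L, |iteratedDeriv 3 W u|) := by
        calc _ ≤ |waveNumber L k| ^ 3 *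
              (‖periodCoeff L P k‖ + L / a * ‖periodCoeff L W k‖) := by
              gcongr; exact (h5 k t ht).trans (by gcongr; exact hdiv k)
          _ = |waveNumber L k| ^ 3 * ‖periodCoeff L P k‖
              + L / a * (|waveNumber L k| ^ 3 * ‖periodCoeff L W k‖) := by ring
          _ ≤ _ := by gcongr
      refine (waveNumber_mul_le_of_cube_le hL hk e3).trans_eq ?_
      congr 1
      field_simp

theorem exists_damped_wave {L a α : ℝ} (hL : 0 < L) (ha : 0 < a) (hα : 0 ≤ α) {P W : ℝ → ℝ}
    (hP : ContDiff ℝ 5 P) (hW : ContDiff ℝ 5 W)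
    (hPp : Function.Periodic P L) (hWp : Function.Periodic W L)
    (hP0 : ∫ u in (0 : ℝ)..L, P u = 0) (hW0 : ∫ u in (0 : ℝ)..L, W u = 0) :
    ∃ (Z Zt Zu D : ℝ → ℝ → ℝ) (K : ℝ), (∀ u, Z 0 u = P u) ∧ (∀ u, Zt 0 u = W u) ∧
      (∀ t, Function.Periodic (Z t) L) ∧
      (∀ t u, -1 < t → DifferentiableAt ℝ (fun p : ℝ × ℝ => Z p.1 p.2) (t, u)) ∧
      (∀ t u, -1 < t → HasDerivAt (Z t) (Zu t u) u) ∧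
      (∀ t, -1 < t → Continuous (Zu t)) ∧
      (∀ t u, -1 < t → HasDerivAt (fun t => Z t u) (Zt t u) t) ∧
      (∀ t u, -1 < t → HasDerivAt (fun t => Zt t u) (a ^ 2 * D t u - α * Zt t u) t) ∧
      (∀ t u h, -1 < t →
        |Z t (u + h) - 2 * Z t u + Z t (u - h) - h ^ 2 * D t u| ≤ |h| ^ 3 * K) ∧
      (∀ t u, 0 ≤ t → |Zu t u| ≤ (L * (∫ u in (0 : ℝ)..L, |iteratedDeriv 3 P u|) +
          L ^ 2 / a * ∫ u in (0 : ℝ)..L, |iteratedDeriv 3 W u|) / 12) := by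
  obtain ⟨g, g', B, B', H, hg0, hg0', hbd⟩ := exists_isModeFamily hL ha hα hP hW hPp hWp hP0 hW0
  refine ⟨fun t u => (∑' k, g k t * planeWave L k u).re,
    fun t u => (∑' k, g' k t * planeWave L k u).re,
    fun t u => (∑' k, g k t * (waveNumber L k * Complex.I * planeWave L k u)).re,
    fun t u => (∑' k, -(waveNumber L k ^ 2 : ℂ) * (g k t * planeWave L k u)).re,
    ∑' k, |waveNumber L k| ^ 3 * B k, fun u => ?_, fun u => ?_, fun t u => ?_,
    fun t u ht => ?_, fun t u ht => ?_, fun t ht => ?_, fun t u ht => ?_, fun t u ht => ?_,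
    fun t u h ht => ?_, fun t u ht => ?_⟩
  · simp only [hg0, (hasSum_periodCoeff hL (hP.of_le (by norm_num)) hPp u).tsum_eq,
      Complex.ofReal_re]
  · simp only [hg0', (hasSum_periodCoeff hL (hW.of_le (by norm_num)) hWp u).tsum_eq,
      Complex.ofReal_re]
  · simp only [planeWave_add, planeWave_period hL, mul_one]
  · exact Complex.reCLM.differentiableAt.comp (t, u) (H.differentiableAt ht u)
  · exact Complex.reCLM.hasFDerivAt.comp_hasDerivAt u (H.hasDerivAt_space ht.le u)
  · exact Complex.continuous_re.comp (H.continuous_space ht.le)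
  · exact Complex.reCLM.hasFDerivAt.comp_hasDerivAt t (H.hasDerivAt_time ht u)
  · refine (Complex.reCLM.hasFDerivAt.comp_hasDerivAt t
      (H.hasDerivAt_time_time hα ht u)).congr_deriv ?_
    simp only [Complex.reCLM_apply, Complex.sub_re, ← Complex.ofReal_pow, Complex.re_ofReal_mul]
  · refine le_trans (le_of_eq_of_le ?_ (Complex.abs_re_le_norm _)) (H.second_difference ht.le u h)
    congr 1
    simp only [Complex.sub_re, Complex.add_re, ← Complex.ofReal_pow, Complex.re_ofReal_mul]
    simp
  · refine (Complex.abs_re_le_norm _).trans ?_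
    refine (tsum_of_norm_bounded (hasSum_int_one_div_sq.mul_left
      ((L * (∫ u in (0 : ℝ)..L, |iteratedDeriv 3 P u|) +
        L ^ 2 / a * ∫ u in (0 : ℝ)..L, |iteratedDeriv 3 W u|) / (4 * Real.pi ^ 2)))
      fun k => ?_).trans_eq ?_
    · refine le_trans (le_of_eq ?_) (hbd k t ht)
      rw [← mul_assoc, IsModeFamily.norm_term]
      simp [mul_comm]
    · have := Real.pi_pos.ne'
      field_simp
      ring

theorem sum_range_mul_second_difference (N : ℕ) {z w : ℤ → ℝ} (hz : Function.Periodic z N)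
    (hw : Function.Periodic w N) :
    ∑ k ∈ Finset.range N, w k * (z (k + 1) - 2 * z k + z (k - 1)) =
      -∑ k ∈ Finset.range N, (z (k + 1) - z k) * (w (k + 1) - w k) := by
  rw [eq_neg_iff_add_eq_zero, ← Finset.sum_add_distrib]
  have h := Finset.sum_range_sub (fun n : ℕ => w n * (z n - z (n - 1))) N
  have h1 : w N = w 0 := by simpa using hw 0
  have h2 : z N = z 0 := by simpa using hz 0
  have h3 : z (N - 1) = z (-1) := by simpa [sub_eq_add_neg, add_comm] using hz (-1)
  simp only [h1, h2, h3, Nat.cast_zero, zero_sub, sub_self] at h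
  rw [← h]
  refine Finset.sum_congr rfl fun k _ => ?_
  push_cast
  rw [add_sub_cancel_right]
  ring

/-- Twice the energy of a periodic chain. -/
noncomputable def chainEnergy (N : ℕ) (ω : ℝ) (z w : ℤ → ℝ → ℝ) (t : ℝ) : ℝ :=
  ∑ k ∈ Finset.range N, (w k t ^ 2 + ω ^ 2 * (z (k + 1) t - z k t) ^ 2)

/-- An `N`-periodic chain of oscillators driven by forces bounded by `ε`. -/
structure IsForcedChain (N : ℕ) (ω α ε : ℝ) (z w τ : ℤ → ℝ → ℝ) : Prop where
  periodic_z : ∀ t, 0 ≤ t → Function.Periodic (fun k => z k t) N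
  periodic_w : ∀ t, 0 ≤ t → Function.Periodic (fun k => w k t) N
  velocity : ∀ k t, 0 ≤ t → HasDerivWithinAt (z k) (w k t) (Ici 0) t
  newton : ∀ k t, 0 ≤ t → HasDerivWithinAt (w k)
    (ω ^ 2 * (z (k + 1) t - 2 * z k t + z (k - 1) t) - α * w k t + τ k t) (Ici 0) t
  force : ∀ k t, 0 ≤ t → |τ k t| ≤ ε

namespace IsForcedChain

variable {N : ℕ} {ω α ε : ℝ} {z w τ : ℤ → ℝ → ℝ}

theorem hasDerivWithinAt_energy (H : IsForcedChain N ω α ε z w τ) {t : ℝ} (ht : 0 ≤ t) :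
    HasDerivWithinAt (chainEnergy N ω z w)
      (∑ k ∈ Finset.range N, (2 * w k t * τ k t - 2 * α * w k t ^ 2)) (Ici 0) t := by
  have h := HasDerivWithinAt.fun_sum (u := Finset.range N) fun k _ =>
    ((H.newton k t ht).pow 2).add
      ((((H.velocity (k + 1) t ht).sub (H.velocity k t ht)).pow 2).const_mul (ω ^ 2))
  refine h.congr_deriv ?_
  have e := sum_range_mul_second_difference N (H.periodic_z t ht) (H.periodic_w t ht)
  rw [eq_neg_iff_add_eq_zero, ← Finset.sum_add_distrib] at e
  have e' := congrArg (fun r => 2 * ω ^ 2 * r) e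
  simp only [Finset.mul_sum, mul_zero] at e'
  rw [← sub_eq_zero, ← Finset.sum_sub_distrib, ← e']
  refine Finset.sum_congr rfl fun k _ => ?_
  simp only [Pi.sub_apply]
  push_cast
  ring

theorem energy_le (H : IsForcedChain N ω α ε z w τ) (hα : 0 ≤ α) {t : ℝ} (ht : 0 ≤ t) :
    chainEnergy N ω z w t ≤ Real.exp t * (chainEnergy N ω z w 0 + N * ε ^ 2 * t) := by
  have hd : ∀ t, 0 ≤ t → HasDerivWithinAt
      (fun t => Real.exp (-t) * chainEnergy N ω z w t - N * ε ^ 2 * t)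
      (Real.exp (-t) * -1 * chainEnergy N ω z w t + Real.exp (-t) *
        (∑ k ∈ Finset.range N, (2 * w k t * τ k t - 2 * α * w k t ^ 2)) - N * ε ^ 2 * 1)
      (Ici 0) t := fun t ht =>
    ((((hasDerivAt_id t).neg.exp).hasDerivWithinAt).mul (H.hasDerivWithinAt_energy ht)).sub
      (((hasDerivAt_id t).const_mul (N * ε ^ 2)).hasDerivWithinAt)
  have hanti := antitoneOn_of_hasDerivWithinAt_nonpos (convex_Ici (0 : ℝ))
    (fun t ht => (hd t ht).continuousWithinAt)
    (fun t ht => (hd t (interior_subset ht)).mono interior_subset) (fun t ht => ?_)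
  · have h1 := hanti (self_mem_Ici (a := (0 : ℝ))) (mem_Ici.2 ht) ht
    simp only [neg_zero, Real.exp_zero, one_mul, mul_zero, sub_zero] at h1
    have h2 : chainEnergy N ω z w t = Real.exp t * (Real.exp (-t) * chainEnergy N ω z w t) := by
      rw [← mul_assoc, ← Real.exp_add]; simp
    rw [h2]
    gcongr
    linarith
  · have ht0 : (0 : ℝ) ≤ t := interior_subset (s := Ici (0 : ℝ)) ht
    have h1 : ∑ k ∈ Finset.range N, (2 * w k t * τ k t - 2 * α * w k t ^ 2) ≤
        chainEnergy N ω z w t + N * ε ^ 2 := by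
      have : (N * ε ^ 2 : ℝ) = ∑ k ∈ Finset.range N, ε ^ 2 := by simp
      rw [chainEnergy, this, ← Finset.sum_add_distrib]
      refine Finset.sum_le_sum fun k _ => ?_
      have h2 : τ k t ^ 2 ≤ ε ^ 2 := sq_le_sq' (abs_le.1 (H.force k t ht0)).1
        (abs_le.1 (H.force k t ht0)).2
      have h3 : 0 ≤ α * w k t ^ 2 := by positivity
      have h4 : 0 ≤ ω ^ 2 * (z (k + 1) t - z k t) ^ 2 := by positivity
      nlinarith [sq_nonneg (w k t - τ k t)]
    have h2 : Real.exp (-t) ≤ 1 := Real.exp_le_one_iff.2 (by linarith)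
    have h3 : 0 ≤ Real.exp (-t) := (Real.exp_pos _).le
    have h4 : (0 : ℝ) ≤ N * ε ^ 2 := by positivity
    have h5 := mul_le_mul_of_nonneg_left h1 h3
    nlinarith [mul_le_mul_of_nonneg_right h2 h4]

end IsForcedChain

theorem abs_sub_le_sum_range {N : ℕ} (z : ℕ → ℝ) {j k : ℕ} (hj : j < N) (hk : k < N) :
    |z j - z k| ≤ ∑ i ∈ Finset.range N, |z (i + 1) - z i| := by
  wlog h : j ≤ k generalizing j k
  · rw [abs_sub_comm]; exact this hk hj (by omega)
  · have h1 := dist_le_Ico_sum_dist z h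
    simp only [Real.dist_eq] at h1
    refine h1.trans ?_
    simp only [abs_sub_comm (z _) (z (_ + 1))]
    refine Finset.sum_le_sum_of_subset_of_nonneg (fun i hi => ?_) fun _ _ _ => abs_nonneg _
    simp only [Finset.mem_Ico, Finset.mem_range] at hi ⊢
    omega

namespace IsForcedChain

variable {N : ℕ} {ω₀ α ε : ℝ} {z w τ : ℤ → ℝ → ℝ}

/-- Stability of the forced chain with stiffness `ω₀ N`. -/
theorem abs_le (H : IsForcedChain N (ω₀ * N) α ε z w τ) (hα : 0 ≤ α) (hω₀ : 0 < ω₀)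
    (hN : 0 < N) {η η' T : ℝ}
    (hw : ∀ k, |w k 0| ≤ η) (hd : ∀ k, N * |z (k + 1) 0 - z k 0| ≤ η)
    (hz : ∀ k, |z k 0| ≤ η') {t : ℝ} (ht : 0 ≤ t) (htT : t ≤ T) (k : ℤ) :
    |z k t| ≤ η' + (T + 1 / ω₀) * √(Real.exp T * ((1 + ω₀ ^ 2) * η ^ 2 + T * ε ^ 2)) := by
  have hN' : (0 : ℝ) < N := by exact_mod_cast hN
  have hT : 0 ≤ T := ht.trans htT
  set S := Real.exp T * ((1 + ω₀ ^ 2) * η ^ 2 + T * ε ^ 2) with hS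
  have hS0 : 0 ≤ S := by positivity
  have hE0 : chainEnergy N (ω₀ * N) z w 0 ≤ N * ((1 + ω₀ ^ 2) * η ^ 2) := by
    have : (N * ((1 + ω₀ ^ 2) * η ^ 2) : ℝ) =
      ∑ k ∈ Finset.range N, ((1 + ω₀ ^ 2) * η ^ 2) := by simp
    rw [this, chainEnergy]
    refine Finset.sum_le_sum fun k _ => ?_
    have h1 : w k 0 ^ 2 ≤ η ^ 2 := by
      rw [← sq_abs]; exact pow_le_pow_left₀ (abs_nonneg _) (hw k) 2
    have h2 : (N * |z (k + 1) 0 - z k 0|) ^ 2 ≤ η ^ 2 :=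
      pow_le_pow_left₀ (by positivity) (hd k) 2
    rw [mul_pow, sq_abs] at h2
    have h3 := mul_le_mul_of_nonneg_left h2 (sq_nonneg ω₀)
    rw [mul_pow]
    linarith
  have hE : ∀ t, 0 ≤ t → t ≤ T → chainEnergy N (ω₀ * N) z w t ≤ N * S := fun t ht htT => by
    refine (H.energy_le hα ht).trans ?_
    have h0 : 0 ≤ chainEnergy N (ω₀ * N) z w 0 := Finset.sum_nonneg fun k _ => by positivity
    calc _ ≤ Real.exp T * (N * ((1 + ω₀ ^ 2) * η ^ 2) + N * ε ^ 2 * T) := by gcongr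
      _ = N * S := by rw [hS]; ring
  have hEv : ∀ t, 0 ≤ t → t ≤ T → ∑ k ∈ Finset.range N, |w k t| ≤ N * √S := fun t ht htT => by
    refine abs_le_of_sq_le_sq' ?_ (by positivity) |>.2
    refine (sq_sum_le_card_mul_sum_sq).trans ?_
    rw [Finset.card_range, mul_pow, Real.sq_sqrt hS0, sq (N : ℝ), mul_assoc]
    gcongr
    refine le_trans ?_ (hE t ht htT)
    refine Finset.sum_le_sum fun k _ => ?_
    rw [sq_abs]
    have : 0 ≤ (ω₀ * N) ^ 2 * (z (k + 1) t - z k t) ^ 2 := by positivity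
    linarith
  have hEd : ∑ k ∈ Finset.range N, |z (k + 1) t - z k t| ≤ 1 / ω₀ * √S := by
    refine abs_le_of_sq_le_sq' ?_ (by positivity) |>.2
    refine (sq_sum_le_card_mul_sum_sq).trans ?_
    rw [Finset.card_range, mul_pow, Real.sq_sqrt hS0]
    have h1 : (ω₀ * N) ^ 2 * ∑ k ∈ Finset.range N, |z (k + 1) t - z k t| ^ 2 ≤ N * S := by
      refine le_trans ?_ (hE t ht htT)
      rw [Finset.mul_sum]
      refine Finset.sum_le_sum fun k _ => ?_
      rw [sq_abs]
      have : 0 ≤ w k t ^ 2 := sq_nonneg _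
      linarith
    rw [div_pow, one_pow, one_div, ← div_eq_inv_mul, le_div_iff₀ (by positivity)]
    refine le_of_mul_le_mul_left ?_ hN'
    linarith
  have hm : |∑ k ∈ Finset.range N, z k t| ≤ N * (η' + T * √S) := by
    have h0 : |∑ k ∈ Finset.range N, z k 0| ≤ N * η' := by
      calc _ ≤ ∑ k ∈ Finset.range N, |z k 0| := Finset.abs_sum_le_sum_abs _ _
        _ ≤ ∑ _k ∈ Finset.range N, η' := Finset.sum_le_sum fun k _ => hz k
        _ = N * η' := by simp
    have h1 := (convex_Icc 0 T).norm_image_sub_le_of_norm_hasDerivWithin_le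
      (f := fun t => ∑ k ∈ Finset.range N, z k t) (C := N * √S)
      (fun s hs => (HasDerivWithinAt.fun_sum (u := Finset.range N) fun k _ =>
        H.velocity k s hs.1).mono Icc_subset_Ici_self)
      (fun s hs => (Finset.abs_sum_le_sum_abs _ _).trans (hEv s hs.1 hs.2))
      (left_mem_Icc.2 hT) ⟨ht, htT⟩
    simp only [Real.norm_eq_abs, sub_zero, abs_of_nonneg ht] at h1
    have h2 := abs_sub_abs_le_abs_sub (∑ k ∈ Finset.range N, z k t) (∑ k ∈ Finset.range N, z k 0)
    have h3 : N * √S * t ≤ N * √S * T := by gcongr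
    linarith
  have hmain : ∀ k : ℕ, k < N → |z k t| ≤ η' + (T + 1 / ω₀) * √S := fun k hk => by
    have h1 : (N : ℝ) * z k t =
        ∑ j ∈ Finset.range N, (z k t - z j t) + ∑ j ∈ Finset.range N, z j t := by
      rw [← Finset.sum_add_distrib]; simp
    have h2 : |∑ j ∈ Finset.range N, (z k t - z j t)| ≤ N * (1 / ω₀ * √S) := by
      refine (Finset.abs_sum_le_sum_abs _ _).trans ?_
      refine (Finset.sum_le_sum fun j hj => ?_).trans_eq
        (b := ∑ j ∈ Finset.range N, (1 / ω₀ * √S)) (by simp)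
      refine (abs_sub_le_sum_range (fun i : ℕ => z i t) hk (Finset.mem_range.1 hj)).trans ?_
      simpa using hEd
    have h3 : N * |z k t| ≤ N * (η' + (T + 1 / ω₀) * √S) := by
      rw [← abs_of_pos hN', ← abs_mul, h1, abs_of_pos hN']
      refine (abs_add_le _ _).trans ?_
      linarith
    exact le_of_mul_le_mul_left h3 hN'
  have hN0 : (N : ℤ) ≠ 0 := by exact_mod_cast hN.ne'
  have hk0 := Int.emod_nonneg k hN0
  have hk1 := Int.emod_lt_of_pos k (b := N) (by exact_mod_cast hN)
  obtain ⟨n, hn⟩ := Int.eq_ofNat_of_zero_le hk0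
  have hzk : z k t = z n t := by
    have := (H.periodic_z t ht).int_mul (k / N) (k % N)
    simp only [Int.cast_id] at this
    rw [mul_comm, Int.emod_add_mul_ediv] at this
    rw [this, hn]
  rw [hzk]
  exact hmain n (by omega)

end IsForcedChain

theorem mul_sub_le_of_le_deriv {F F' : ℝ → ℝ} {m : ℝ} (hF : ∀ u, HasDerivAt F (F' u) u)
    (hm : ∀ u, m ≤ F' u) {u w : ℝ} (h : u ≤ w) : m * (w - u) ≤ F w - F u := by
  have hmono : Monotone fun u => F u - m * u :=
    monotone_of_hasDerivAt_nonneg (fun u => (hF u).sub ((hasDerivAt_id u).const_mul m))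
      fun u => by simpa using hm u
  have := hmono h
  simp only at this
  linarith

theorem sub_le_mul_of_deriv_le {F F' : ℝ → ℝ} {m : ℝ} (hF : ∀ u, HasDerivAt F (F' u) u)
    (hm : ∀ u, F' u ≤ m) {u w : ℝ} (h : u ≤ w) : F w - F u ≤ m * (w - u) := by
  have := mul_sub_le_of_le_deriv (fun u => (hF u).neg) (fun u => neg_le_neg (hm u)) h
  simp only [Pi.neg_apply] at this
  linarith

theorem exists_diffeomorph_of_le_deriv {F F' : ℝ → ℝ} {m : ℝ} (hm0 : 0 < m)
    (hF : ∀ u, HasDerivAt F (F' u) u) (hc : Continuous F') (hm : ∀ u, m ≤ F' u) :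
    ∃ Φ : ℝ ≃ₘ^1⟮𝓘(ℝ, ℝ), 𝓘(ℝ, ℝ)⟯ ℝ, ∀ u, Φ u = F u := by
  have hcont : Continuous F := continuous_iff_continuousAt.2 fun u => (hF u).continuousAt
  have hmono : StrictMono F := strictMono_of_hasDerivAt_pos hF fun u => hm0.trans_le (hm u)
  have htop : Tendsto F atTop atTop := by
    refine tendsto_atTop_mono' atTop ?_
      (tendsto_atTop_add_const_right atTop (F 0) (tendsto_id.const_mul_atTop hm0))
    filter_upwards [eventually_ge_atTop 0] with u hu
    have := mul_sub_le_of_le_deriv hF hm hu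
    simp only [id]
    linarith
  have hbot : Tendsto F atBot atBot := by
    refine tendsto_atBot_mono' atBot ?_
      (tendsto_atBot_add_const_right atBot (F 0) (tendsto_id.const_mul_atBot hm0))
    filter_upwards [eventually_le_atBot 0] with u hu
    have := mul_sub_le_of_le_deriv hF hm hu
    simp only [id]
    linarith
  set e : ℝ ≃ₜ ℝ := (hmono.orderIsoOfSurjective F (hcont.surjective htop hbot)).toHomeomorph
  have he : ∀ u, e u = F u := fun u => rfl
  have hF1 : ContDiff ℝ 1 F := by
    rw [contDiff_one_iff_deriv]
    exact ⟨fun u => (hF u).differentiableAt, by rwa [funext fun u => (hF u).deriv]⟩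
  exact ⟨⟨e.toEquiv, contMDiff_iff_contDiff.2 hF1, contMDiff_iff_contDiff.2
    (e.contDiff_symm_deriv (fun u => (hm0.trans_le (hm u)).ne') hF hF1)⟩, he⟩

/-- The normalized antiderivative of a smooth periodic function of mean `b`. -/
theorem exists_periodic_antiderivative {L b : ℝ} (hL : 0 < L) {G : ℝ → ℝ} (hG : ContDiff ℝ 4 G)
    (hper : Function.Periodic G L) (hint : ∫ u in (0 : ℝ)..L, G u = b * L) :
    ∃ (P : ℝ → ℝ) (c : ℝ), (∀ u, P u + b * u + c = ∫ s in (0 : ℝ)..u, G s) ∧ ContDiff ℝ 5 P ∧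
      Function.Periodic P L ∧ (∫ u in (0 : ℝ)..L, P u = 0) ∧
      iteratedDeriv 3 P = iteratedDeriv 2 G := by
  have hd : ∀ c u, HasDerivAt (fun u => (∫ s in (0 : ℝ)..u, G s) - b * u - c) (G u - b) u :=
    fun c u => by
      have h1 := intervalIntegral.integral_hasDerivAt_right (hG.continuous.intervalIntegrable 0 u)
        (hG.continuous.stronglyMeasurableAtFilter _ _) hG.continuous.continuousAt
      simpa using (h1.sub ((hasDerivAt_id u).const_mul b)).sub_const c
  set R : ℝ → ℝ := fun u => (∫ s in (0 : ℝ)..u, G s) - b * u - 0 with hR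
  set c : ℝ := (∫ u in (0 : ℝ)..L, R u) / L with hc
  have hRc : Continuous R := continuous_iff_continuousAt.2 fun u => (hd 0 u).continuousAt
  have hderiv : deriv (fun u => (∫ s in (0 : ℝ)..u, G s) - b * u - c) = fun u => G u - b :=
    funext fun u => (hd c u).deriv
  refine ⟨fun u => (∫ s in (0 : ℝ)..u, G s) - b * u - c, c, fun u => by ring, ?_, fun u => ?_,
    ?_, ?_⟩
  · rw [show (5 : WithTop ℕ∞) = 4 + 1 by norm_num, contDiff_succ_iff_deriv]
    refine ⟨fun u => (hd c u).differentiableAt, by simp, ?_⟩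
    rw [hderiv]
    exact hG.sub contDiff_const
  · have h1 := intervalIntegral.integral_add_adjacent_intervals
      (hG.continuous.intervalIntegrable (μ := MeasureTheory.volume) 0 u)
      (hG.continuous.intervalIntegrable u (u + L))
    have h2 := hper.intervalIntegral_add_eq u 0
    rw [zero_add, hint] at h2
    simp only [← h1, h2]
    ring
  · have : ∀ u, (∫ s in (0 : ℝ)..u, G s) - b * u - c = R u - c := fun u => by simp [hR]
    simp only [this]
    rw [intervalIntegral.integral_sub (hRc.intervalIntegrable _ _) (by simp)]
    simp [hc]
    field_simp
    ring
  · have hb : deriv (fun u => G u - b) = deriv G := funext fun u => by simp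
    rw [iteratedDeriv_succ', hderiv, iteratedDeriv_succ', hb, ← iteratedDeriv_succ']

theorem exists_damped_motion (α : ℝ) {f : ℝ → ℝ} (hf : Continuous f) (p w : ℝ) :
    ∃ M M' : ℝ → ℝ, (∀ t, HasDerivAt M (M' t) t) ∧ (∀ t, HasDerivAt M' (-(α * M' t) + f t) t) ∧
      M 0 = p ∧ M' 0 = w := by
  have hprim : ∀ {g : ℝ → ℝ} (_ : Continuous g) (c t : ℝ),
      HasDerivAt (fun t => c + ∫ s in (0 : ℝ)..t, g s) (g t) t := fun hg c t =>
    (intervalIntegral.integral_hasDerivAt_right (hg.intervalIntegrable 0 t)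
      (hg.stronglyMeasurableAtFilter _ _) hg.continuousAt).const_add c
  have hE : ∀ c t : ℝ, HasDerivAt (fun t => Real.exp (c * t)) (Real.exp (c * t) * c) t :=
    fun c t => by simpa using ((hasDerivAt_id t).const_mul c).exp
  have hg : Continuous fun s => Real.exp (α * s) * f s := by fun_prop
  set M' : ℝ → ℝ := fun t =>
    Real.exp (-α * t) * (w + ∫ s in (0 : ℝ)..t, Real.exp (α * s) * f s) with hM'
  have hd : ∀ t, HasDerivAt M' (-(α * M' t) + f t) t := fun t => by
    refine ((hE (-α) t).mul (hprim hg w t)).congr_deriv ?_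
    have : Real.exp (-α * t) * Real.exp (α * t) = 1 := by rw [← Real.exp_add]; simp
    rw [← mul_assoc, this, hM']
    ring
  have hc : Continuous M' := continuous_iff_continuousAt.2 fun t => (hd t).continuousAt
  exact ⟨fun t => p + ∫ s in (0 : ℝ)..t, M' s, M', hprim hc p, hd, by simp, by simp [hM']⟩

/-- The continuum limit in the Lagrangian coordinate `u`: a classical solution of
`y_tt = (ω₀ L)² y_uu - α y_t + f`. -/
theorem exists_continuum_limit {L ω₀ α δ C₁ C₂ v₀ : ℝ} (hL : 0 < L) (hω₀ : 0 < ω₀)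
    (hα : 0 ≤ α) {f X V : ℝ → ℝ} (hf : Continuous f) (hXV : IsProfile L X V)
    (hC₁ : 0 < C₁) (hC₂ : 0 < C₂) (hδ₁ : δ < 1) (hγ : gammaConst L ω₀ α X V C₁ C₂ < δ) :
    ∃ (y yt yu r : ℝ → ℝ → ℝ) (K m : ℝ), 0 < m ∧ (∀ u, y 0 u = ∫ s in (0 : ℝ)..u, X s) ∧
      (∀ u, yt 0 u = v₀ + ∫ s in (0 : ℝ)..u, V s) ∧
      (∀ t u, y t (u + L) = y t u + L) ∧
      (∀ t u, -1 < t → DifferentiableAt ℝ (fun p : ℝ × ℝ => y p.1 p.2) (t, u)) ∧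
      (∀ t u, -1 < t → HasDerivAt (y t) (yu t u) u) ∧
      (∀ t, -1 < t → Continuous (yu t)) ∧
      (∀ t u, -1 < t → HasDerivAt (fun t => y t u) (yt t u) t) ∧
      (∀ t u, -1 < t → HasDerivAt (fun t => yt t u) (r t u) t) ∧
      (∀ t u h, -1 < t → 0 < h →
        |r t u - ((ω₀ * L / h) ^ 2 * (y t (u + h) - 2 * y t u + y t (u - h))
          - α * yt t u + f t)| ≤ K * h) ∧
      (∀ t u, 0 ≤ t → m ≤ yu t u ∧ yu t u ≤ 2) := by
  obtain ⟨P, m₀, hP, hPc, hPp, hP0, hP3⟩ := exists_periodic_antiderivative (b := 1) hL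
    hXV.contDiff_X hXV.periodic_X (by simpa using hXV.integral_X)
  obtain ⟨W, w₀, hW, hWc, hWp, hW0, hW3⟩ := exists_periodic_antiderivative (b := 0) hL
    hXV.contDiff_V hXV.periodic_V (by simpa using hXV.integral_V)
  obtain ⟨M, M', hM, hM', hM0, hM0'⟩ := exists_damped_motion α hf m₀ (w₀ + v₀)
  obtain ⟨Z, Zt, Zu, D, K, z1, z2, z3, z4, z5, z6, z7, z8, z9, z10⟩ :=
    exists_damped_wave hL (mul_pos hω₀ hL) hα hPc hWc hPp hWp hP0 hW0
  set θ := (fluctuation L X + fluctuation L V / ω₀) / 12 with hθ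
  have hθ' : (L * (∫ u in (0 : ℝ)..L, |iteratedDeriv 3 P u|) +
      L ^ 2 / (ω₀ * L) * ∫ u in (0 : ℝ)..L, |iteratedDeriv 3 W u|) / 12 = θ := by
    rw [hP3, hW3, hθ, fluctuation, fluctuation]
    field_simp
  rw [hθ'] at z10
  have hc : ∀ g : ℝ → ℝ, 0 ≤ fluctuation L g := fun g =>
    mul_nonneg hL.le (intervalIntegral.integral_nonneg hL.le fun _ _ => abs_nonneg _)
  have hθ1 : θ < 1 := by
    refine lt_of_le_of_lt ?_ (hγ.trans hδ₁)
    have hc1 := hc X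
    have hc2 : 0 ≤ fluctuation L V / ω₀ := div_nonneg (hc V) hω₀.le
    have h1 : 0 ≤ C₁ / L := by positivity
    have h2 : 0 ≤ C₂ / L / (4 * ω₀) := by positivity
    have h3 : 0 ≤ α / (8 * ω₀) * (2 * fluctuation L X + C₁ / L) := by positivity
    have h4 : gammaConst L ω₀ α X V C₁ C₂ = 2 * fluctuation L X + C₁ / L +
        α / (8 * ω₀) * (2 * fluctuation L X + C₁ / L) + fluctuation L V / ω₀ / 2 +
        C₂ / L / (4 * ω₀) := by
      rw [gammaConst]; field_simp; ring
    rw [h4, hθ]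
    linarith
  refine ⟨fun t u => u + M t + Z t u, fun t u => M' t + Zt t u, fun t u => 1 + Zu t u,
    fun t u => (-(α * M' t) + f t) + ((ω₀ * L) ^ 2 * D t u - α * Zt t u), (ω₀ * L) ^ 2 * K, 1 - θ,
    by linarith, fun u => ?_, fun u => ?_, fun t u => ?_, fun t u ht => ?_, fun t u ht => ?_,
    fun t ht => ?_, fun t u ht => ?_, fun t u ht => ?_, fun t u h ht hh => ?_, fun t u ht => ?_⟩
  · simp only [hM0, z1]; linarith [hP u]
  · simp only [hM0', z2]; linarith [hW u]
  · simp only [z3 t u]; ring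
  · have h1 : DifferentiableAt ℝ (fun p : ℝ × ℝ => M p.1) (t, u) :=
      (hM t).differentiableAt.comp (t, u) differentiableAt_fst
    exact (differentiableAt_snd.add h1).add (z4 t u ht)
  · exact ((hasDerivAt_id u).add_const (M t)).add (z5 t u ht)
  · exact continuous_const.add (z6 t ht)
  · exact ((hM t).const_add u).add (z7 t u ht)
  · exact (hM' t).add (z8 t u ht)
  · have e : (-(α * M' t) + f t) + ((ω₀ * L) ^ 2 * D t u - α * Zt t u) -
        ((ω₀ * L / h) ^ 2 * (u + h + M t + Z t (u + h) - 2 * (u + M t + Z t u)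
          + (u - h + M t + Z t (u - h))) - α * (M' t + Zt t u) + f t) =
        -((ω₀ * L / h) ^ 2 *
          (Z t (u + h) - 2 * Z t u + Z t (u - h) - h ^ 2 * D t u)) := by
      field_simp
      ring
    rw [e, abs_neg, abs_mul, abs_of_nonneg (sq_nonneg _)]
    refine (mul_le_mul_of_nonneg_left (z9 t u h ht) (sq_nonneg _)).trans_eq ?_
    rw [abs_of_pos hh]
    field_simp
  · have := abs_le.1 (z10 t u ht)
    constructor <;> linarith [this.1, this.2]

theorem mul_abs_sub_le_of_le_deriv {F F' : ℝ → ℝ} {m : ℝ} (hF : ∀ u, HasDerivAt F (F' u) u)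
    (hm : ∀ u, m ≤ F' u) (u w : ℝ) : m * |w - u| ≤ |F w - F u| := by
  wlog h : u ≤ w generalizing u w
  · rw [abs_sub_comm, abs_sub_comm (F w)]; exact this w u (le_of_not_ge h)
  · rw [abs_of_nonneg (sub_nonneg.2 h)]
    exact (mul_sub_le_of_le_deriv hF hm h).trans (le_abs_self _)

theorem abs_sub_le_of_deriv_mem {F F' : ℝ → ℝ} {m M : ℝ} (hm0 : 0 ≤ m)
    (hF : ∀ u, HasDerivAt F (F' u) u)
    (hm : ∀ u, m ≤ F' u) (hM : ∀ u, F' u ≤ M) (u w : ℝ) : |F w - F u| ≤ M * |w - u| := by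
  wlog h : u ≤ w generalizing u w
  · rw [abs_sub_comm, abs_sub_comm w]; exact this w u (le_of_not_ge h)
  · have h1 := mul_sub_le_of_le_deriv hF hm h
    have h2 : 0 ≤ m * (w - u) := mul_nonneg hm0 (sub_nonneg.2 h)
    rw [abs_of_nonneg (sub_nonneg.2 h), abs_of_nonneg (h2.trans h1)]
    exact sub_le_mul_of_deriv_le hF hM h

theorem exists_rectangle_rule {L : ℝ} (hL : 0 < L) {G : ℝ → ℝ} (hG : ContDiff ℝ 4 G)
    (hper : Function.Periodic G L) : ∃ Λ : ℝ, 0 ≤ Λ ∧ ∀ u h : ℝ, 0 ≤ h →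
      |h * G u - ((∫ s in (0 : ℝ)..(u + h), G s) - ∫ s in (0 : ℝ)..u, G s)| ≤ Λ * h ^ 2 := by
  have hG1 : ContDiff ℝ 1 G := hG.of_le (by norm_num)
  obtain ⟨Λ, hΛ⟩ := isCompact_Icc.exists_bound_of_continuousOn (s := Icc (0 : ℝ) L)
    (hG1.continuous_deriv le_rfl).continuousOn
  have hb : ∀ u, ‖deriv G u‖ ≤ Λ := fun u => by
    obtain ⟨w, hw, hwu⟩ := hper.deriv_real.exists_mem_Ico₀ hL u
    rw [hwu]; exact hΛ w (Ico_subset_Icc_self hw)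
  refine ⟨Λ, (norm_nonneg _).trans (hb 0), fun u h hh => ?_⟩
  have hi : ∀ p q, IntervalIntegrable G MeasureTheory.volume p q := fun p q =>
    hG.continuous.intervalIntegrable p q
  rw [intervalIntegral.integral_interval_sub_left (hi _ _) (hi _ _)]
  have h1 : h * G u = ∫ _ in u..(u + h), G u := by simp
  rw [h1, ← intervalIntegral.integral_sub (by simp) (hi _ _)]
  have h2 := intervalIntegral.norm_integral_le_of_norm_le_const (a := u) (b := u + h)
    (f := fun s => G u - G s) (C := Λ * h) fun s hs => ?_
  · rw [add_sub_cancel_left, abs_of_nonneg hh, Real.norm_eq_abs] at h2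
    linarith
  · rw [uIoc_of_le (by linarith)] at hs
    have h3 := convex_univ.norm_image_sub_le_of_norm_deriv_le (f := G) (C := Λ)
      (fun x _ => (hG1.differentiable one_ne_zero).differentiableAt) (fun x _ => hb x)
      (mem_univ s) (mem_univ u)
    refine h3.trans (mul_le_mul_of_nonneg_left ?_ ((norm_nonneg _).trans (hb 0)))
    rw [Real.norm_eq_abs, abs_sub_comm, abs_of_pos (by linarith [hs.1])]
    linarith [hs.2]

theorem abs_le_of_abs_sub_le {N : ℕ} (hN : 0 < N) {b : ℤ → ℝ} (hb : Function.Periodic b N)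
    {A : ℝ} (h : ∀ k, |b (k + 1) - b k| ≤ A / (N : ℝ) ^ 2) (k : ℤ) : |b k| ≤ |b 0| + A / N := by
  have hN' : (0 : ℝ) < N := by exact_mod_cast hN
  have hk0 := Int.emod_nonneg k (b := (N : ℤ)) (by omega)
  have hk1 := Int.emod_lt_of_pos k (b := N) (by exact_mod_cast hN)
  obtain ⟨n, hn⟩ := Int.eq_ofNat_of_zero_le hk0
  have hbk : b k = b n := by
    have := hb.int_mul (k / N) (k % N)
    simp only [Int.cast_id] at this
    rw [mul_comm, Int.emod_add_mul_ediv] at this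
    rw [this, hn]
  have h1 := abs_sub_le_sum_range (N := N) (fun i : ℕ => b i) (j := n) (k := 0) (by omega) hN
  have h2 : ∑ i ∈ Finset.range N, |b ((i + 1 : ℕ) : ℤ) - b i| ≤ A / N := by
    calc _ ≤ ∑ _i ∈ Finset.range N, A / (N : ℝ) ^ 2 :=
          Finset.sum_le_sum fun i _ => by push_cast; exact h i
      _ = A / N := by simp; field_simp
  have h3 := abs_sub_abs_le_abs_sub (b n) (b 0)
  rw [hbk]
  simp only [Nat.cast_zero] at h1
  linarith

/-- Uniform convergence of the chain to the continuum limit at the grid points. -/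
theorem exists_uniform_approximation
    {L ω₀ α : ℝ} (hL : 0 < L) (hω₀ : 0 < ω₀) (hα : 0 ≤ α)
    {f X V : ℝ → ℝ} (hXV : IsProfile L X V) {C₁ C₂ : ℝ}
    {x v : ℕ → ℤ → ℝ → ℝ}
    (hsol : ∀ᶠ N : ℕ in atTop, IsChainSolution N L (ω₀ * N) α f (x N) (v N))
    (hord : ∀ᶠ N : ℕ in atTop, IsOrderedConfiguration N L (fun k => x N k 0))
    (hprof : ∀ᶠ N : ℕ in atTop,
      FollowsProfile N L X V C₁ C₂ (fun k => x N k 0) (fun k => v N k 0))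
    {v₀ : ℝ} (hv₀ : Tendsto (fun N : ℕ => v N 0 0) atTop (𝓝 v₀))
    {y yt r : ℝ → ℝ → ℝ} {K : ℝ} (hy0 : ∀ u, y 0 u = ∫ s in (0 : ℝ)..u, X s)
    (hyt0 : ∀ u, yt 0 u = v₀ + ∫ s in (0 : ℝ)..u, V s)
    (hyp : ∀ t u, y t (u + L) = y t u + L)
    (hyt : ∀ t u, -1 < t → HasDerivAt (fun t => y t u) (yt t u) t)
    (hytt : ∀ t u, -1 < t → HasDerivAt (fun t => yt t u) (r t u) t)
    (hr : ∀ t u h, -1 < t → 0 < h →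
        |r t u - ((ω₀ * L / h) ^ 2 * (y t (u + h) - 2 * y t u + y t (u - h))
          - α * yt t u + f t)| ≤ K * h) (T : ℝ) :
    ∃ b : ℕ → ℝ, Tendsto b atTop (𝓝 0) ∧ ∀ᶠ N : ℕ in atTop, ∀ (k : ℤ) (t : ℝ), 0 ≤ t → t ≤ T →
      |x N k t - y t (k * L / N)| ≤ b N := by
  obtain ⟨Λ₁, hΛ₁, hX⟩ := exists_rectangle_rule hL hXV.contDiff_X hXV.periodic_X
  obtain ⟨Λ₂, hΛ₂, hV⟩ := exists_rectangle_rule hL hXV.contDiff_V hXV.periodic_V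
  set A₁ := C₁ + Λ₁ * L ^ 2
  set A₂ := C₂ + Λ₂ * L ^ 2
  refine ⟨fun N => A₁ / N + (T + 1 / ω₀) * √(Real.exp T *
    ((1 + ω₀ ^ 2) * (|A₁| / N + (|v N 0 0 - v₀| + |A₂| / N)) ^ 2 + T * (K * L / N) ^ 2)), ?_, ?_⟩
  · have h0 : ∀ c : ℝ, Tendsto (fun N : ℕ => c / N) atTop (𝓝 0) :=
      fun c => tendsto_const_div_atTop_nhds_zero_nat c
    have h1 : Tendsto (fun N : ℕ => |v N 0 0 - v₀|) atTop (𝓝 0) := by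
      simpa using (hv₀.sub_const v₀).abs
    have h2 := ((h0 |A₁|).add (h1.add (h0 |A₂|))).pow 2 |>.const_mul (1 + ω₀ ^ 2)
    have h3 := (((h0 (K * L)).pow 2).const_mul T)
    have h4 := ((((h2.add h3).const_mul (Real.exp T)).sqrt).const_mul (T + 1 / ω₀))
    simpa using (h0 A₁).add h4
  · filter_upwards [hsol, hord, hprof, eventually_gt_atTop 0] with N hs ho hp hN k t ht htT
    have hN' : (0 : ℝ) < N := by exact_mod_cast hN
    have hN0 := hN'.ne'
    have hstep : ∀ k : ℤ, ((k + 1 : ℤ) : ℝ) * L / N = k * L / N + L / N := fun k => by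
      push_cast; ring
    have hstep' : ∀ k : ℤ, ((k - 1 : ℤ) : ℝ) * L / N = k * L / N - L / N := fun k => by
      push_cast; ring
    set z : ℤ → ℝ → ℝ := fun k t => x N k t - y t (k * L / N) with hz
    set w : ℤ → ℝ → ℝ := fun k t => v N k t - yt t (k * L / N) with hw
    set τ : ℤ → ℝ → ℝ := fun k t => (ω₀ * N) ^ 2 * (y t (k * L / N + L / N)
      - 2 * y t (k * L / N) + y t (k * L / N - L / N)) - α * yt t (k * L / N) + f t
      - r t (k * L / N) with hτ
    have hzp : ∀ t, 0 ≤ t → Function.Periodic (fun k => z k t) N := fun t ht k => by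
      have e : ((k + N : ℤ) : ℝ) * L / N = k * L / N + L := by
        push_cast; field_simp
      simp only [hz, e, hyp, hs.periodic k t ht]
      ring
    have hzd : ∀ k t, 0 ≤ t → HasDerivWithinAt (z k) (w k t) (Ici 0) t := fun k t ht =>
      (hs.velocity k t ht).sub (hyt t _ (by linarith)).hasDerivWithinAt
    have hwp : ∀ t, 0 ≤ t → Function.Periodic (fun k => w k t) N := fun t ht k =>
      (uniqueDiffOn_Ici (0 : ℝ) t ht).eq_deriv _
        ((hzd (k + N) t ht).congr (fun s hs => (hzp s hs k).symm) (hzp t ht k).symm)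
        (hzd k t ht)
    have H : IsForcedChain N (ω₀ * N) α (K * L / N) z w τ := by
      refine ⟨hzp, hwp, hzd, fun k t ht => ?_, fun k t ht => ?_⟩
      · refine ((hs.newton k t ht).sub
          (hytt t (k * L / N) (by linarith)).hasDerivWithinAt).congr_deriv ?_
        simp only [hz, hw, hτ, hstep, hstep']
        ring
      · have h1 := hr t (k * L / N) (L / N) (by linarith) (by positivity)
        have e : ω₀ * L / (L / N) = ω₀ * N := by field_simp
        rw [e, abs_sub_comm] at h1
        rw [mul_div_assoc]
        exact h1
    have hz1 : ∀ k, |z (k + 1) 0 - z k 0| ≤ A₁ / (N : ℝ) ^ 2 := fun k => by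
      have h1 := hp.position k
      have h2 := hX (k * L / N) (L / N) (by positivity)
      have e : z (k + 1) 0 - z k 0 = (x N (k + 1) 0 - x N k 0 - L / N * X (k * L / N)) +
          (L / N * X (k * L / N) - ((∫ s in (0 : ℝ)..(k * L / N + L / N), X s)
            - ∫ s in (0 : ℝ)..(k * L / N), X s)) := by
        simp only [hz, hstep, hy0]; ring
      rw [e]
      calc _ ≤ C₁ / (N : ℝ) ^ 2 + Λ₁ * (L / N) ^ 2 := (abs_add_le _ _).trans (add_le_add h1.le h2)
        _ = _ := by ring
    have hw1 : ∀ k, |w (k + 1) 0 - w k 0| ≤ A₂ / (N : ℝ) ^ 2 := fun k => by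
      have h1 := hp.velocity k
      have h2 := hV (k * L / N) (L / N) (by positivity)
      have e : w (k + 1) 0 - w k 0 = (v N (k + 1) 0 - v N k 0 - L / N * V (k * L / N)) +
          (L / N * V (k * L / N) - ((∫ s in (0 : ℝ)..(k * L / N + L / N), V s)
            - ∫ s in (0 : ℝ)..(k * L / N), V s)) := by
        simp only [hw, hstep, hyt0]; ring
      rw [e]
      calc _ ≤ C₂ / (N : ℝ) ^ 2 + Λ₂ * (L / N) ^ 2 := (abs_add_le _ _).trans (add_le_add h1.le h2)
        _ = _ := by ring
    have hz00 : z 0 0 = 0 := by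
      have : x N 0 0 = 0 := ho.zero
      simp [hz, this, hy0]
    have hw00 : w 0 0 = v N 0 0 - v₀ := by simp [hw, hyt0]
    have hz2 := abs_le_of_abs_sub_le hN (hzp 0 le_rfl) hz1
    have hw2 := abs_le_of_abs_sub_le hN (hwp 0 le_rfl) hw1
    simp only [hz00, hw00, abs_zero, zero_add] at hz2 hw2
    refine H.abs_le hα hω₀ hN (fun k => ?_) (fun k => ?_) hz2 ht htT k
    · have h1 : A₂ / N ≤ |A₂| / N := by gcongr; exact le_abs_self _
      have h2 : 0 ≤ |A₁| / N := by positivity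
      linarith [hw2 k]
    · have h1 : A₁ / N ≤ |A₁| / N := by gcongr; exact le_abs_self _
      have h2 : 0 ≤ |v N 0 0 - v₀| + |A₂| / N := by positivity
      have h3 := mul_le_mul_of_nonneg_left (hz1 k) hN'.le
      have h4 : N * (A₁ / (N : ℝ) ^ 2) = A₁ / N := by field_simp
      linarith

theorem mainTheorem2
    (L ω₀ α : ℝ) (hL : 0 < L) (hω₀ : 0 < ω₀) (hα : 0 ≤ α)
    (f : ℝ → ℝ) (hf : ContDiff ℝ 2 f)
    (X V : ℝ → ℝ) (hXV : IsProfile L X V)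
    (C₁ C₂ : ℝ) (hC₁ : 0 < C₁) (hC₂ : 0 < C₂)
    (δ : ℝ) (hδ₀ : 0 < δ) (hδ₁ : δ < 1)
    (hγ : gammaConst L ω₀ α X V C₁ C₂ < δ)
    (x v : ℕ → ℤ → ℝ → ℝ)
    (hsol : ∀ᶠ N : ℕ in atTop, IsChainSolution N L (ω₀ * N) α f (x N) (v N))
    (hord : ∀ᶠ N : ℕ in atTop, IsOrderedConfiguration N L (fun k => x N k 0))
    (hprof : ∀ᶠ N : ℕ in atTop,
      FollowsProfile N L X V C₁ C₂ (fun k => x N k 0) (fun k => v N k 0))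
    (v₀ : ℝ) (hv₀ : Tendsto (fun N : ℕ => v N 0 0) atTop (𝓝 v₀)) :
    ∃ Y : ℝ → ℝ → ℝ,
      (∀ T : ℝ, 0 < T →
        TendstoUniformlyOn
          (fun (N : ℕ) (p : ℝ × ℝ) => x N (particleIndex (fun k => x N k 0) p.2) p.1)
          (fun p : ℝ × ℝ => Y p.1 p.2) atTop (Icc 0 T ×ˢ univ)) ∧
      (∀ t : ℝ, 0 ≤ t → ∀ y : ℝ, Y t (y + L) = Y t y + L) ∧
      DifferentiableOn ℝ (fun p : ℝ × ℝ => Y p.1 p.2) (Ici 0 ×ˢ univ) ∧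
      (∀ t : ℝ, 0 ≤ t → StrictMono (Y t)) ∧
      (∀ t : ℝ, 0 ≤ t →
        ∃ Φ : ℝ ≃ₘ^1⟮𝓘(ℝ, ℝ), 𝓘(ℝ, ℝ)⟯ ℝ, ∀ y : ℝ, Φ y = Y t y) := by
  obtain ⟨y, yt, yu, r, K, m, hm, hy0, hyt0, hyp, hyd, hyu, hyuc, hyt, hytt, hr, hb⟩ :=
    exists_continuum_limit (v₀ := v₀) hL hω₀ hα hf.continuous hXV hC₁ hC₂ hδ₁ hγ
  have hneg : ∀ {t : ℝ}, 0 ≤ t → -1 < t := fun ht => by linarith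
  have hdiffeo : ∀ t : ℝ, 0 ≤ t → ∃ Φ : ℝ ≃ₘ^1⟮𝓘(ℝ, ℝ), 𝓘(ℝ, ℝ)⟯ ℝ, ∀ u, Φ u = y t u :=
    fun t ht => exists_diffeomorph_of_le_deriv hm (fun u => hyu t u (hneg ht)) (hyuc t (hneg ht))
      fun u => (hb t u ht).1
  have hmono : ∀ t : ℝ, 0 ≤ t → StrictMono (y t) := fun t ht =>
    strictMono_of_hasDerivAt_pos (fun u => hyu t u (hneg ht)) fun u => hm.trans_le (hb t u ht).1
  obtain ⟨Ξ, hΞ⟩ := hdiffeo 0 le_rfl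
  have hΞs : ∀ s, y 0 (Ξ.symm s) = s := fun s => by rw [← hΞ]; exact Ξ.apply_symm_apply s
  refine ⟨fun t s => y t (Ξ.symm s), fun T hT => ?_, fun t ht s => ?_, fun p hp => ?_,
    fun t ht => ?_, fun t ht => ?_⟩
  · obtain ⟨b, hb0, hbN⟩ := exists_uniform_approximation hL hω₀ hα hXV hsol hord hprof hv₀
      hy0 hyt0 hyp hyt hytt hr T
    rw [Metric.tendstoUniformlyOn_iff]
    intro ε hε
    have hlim : Tendsto (fun N : ℕ => b N + 2 * ((3 * b N + 2 * (L / N)) / m)) atTop (𝓝 0) := by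
      have h1 := ((hb0.const_mul 3).add
        ((tendsto_const_div_atTop_nhds_zero_nat L).const_mul 2)).div_const m
      simpa using hb0.add (h1.const_mul 2)
    filter_upwards [hbN, hord, eventually_gt_atTop 0, hlim.eventually_lt_const hε]
      with N hN ho hN0 hlt p hp
    have hN' : (0 : ℝ) < N := by exact_mod_cast hN0
    have ht : 0 ≤ p.1 := hp.1.1
    obtain ⟨hk1, hk2⟩ := (particleIndex_eq_iff hL ho p.2 _).1 rfl
    set k := particleIndex (fun k => x N k 0) p.2
    set s := Ξ.symm p.2
    have e1 := hN k p.1 ht hp.1.2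
    have e2 := hN k 0 le_rfl hT.le
    have e3 := hN (k + 1) 0 le_rfl hT.le
    have hgap : y 0 ((k + 1 : ℤ) * L / N) - y 0 (k * L / N) ≤ 2 * (L / N) := by
      have h1 : (k : ℝ) * L / N ≤ (k + 1 : ℤ) * L / N := by
        push_cast; gcongr; linarith
      refine (sub_le_mul_of_deriv_le (fun u => hyu 0 u (hneg le_rfl))
        (fun u => (hb 0 u le_rfl).2) h1).trans_eq ?_
      push_cast; ring
    have e4 : |y 0 (k * L / N) - y 0 s| ≤ 3 * b N + 2 * (L / N) := by
      rw [hΞs, abs_le]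
      rw [abs_le] at e2 e3
      constructor <;> linarith [e2.1, e2.2, e3.1, e3.2, (abs_nonneg _).trans (hN k 0 le_rfl hT.le),
        div_pos hL hN']
    have e5 : |k * L / N - s| ≤ (3 * b N + 2 * (L / N)) / m := by
      rw [le_div_iff₀ hm, mul_comm]
      exact (mul_abs_sub_le_of_le_deriv (fun u => hyu 0 u (hneg le_rfl))
        (fun u => (hb 0 u le_rfl).1) s (k * L / N)).trans e4
    have e6 : |y p.1 (k * L / N) - y p.1 s| ≤ 2 * |k * L / N - s| :=
      abs_sub_le_of_deriv_mem hm.le (fun u => hyu p.1 u (hneg ht)) (fun u => (hb p.1 u ht).1)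
        (fun u => (hb p.1 u ht).2) s _
    rw [dist_comm, Real.dist_eq]
    have e7 := abs_sub_le (x N k p.1) (y p.1 (k * L / N)) (y p.1 s)
    linarith
  · have : Ξ.symm (s + L) = Ξ.symm s + L := (hmono 0 le_rfl).injective (by rw [hyp, hΞs, hΞs])
    simp only [this, hyp]
  · have hd : Differentiable ℝ Ξ.symm :=
      (contMDiff_iff_contDiff.1 Ξ.symm.contMDiff).differentiable one_ne_zero
    have h1 : DifferentiableAt ℝ (fun p : ℝ × ℝ => (p.1, Ξ.symm p.2)) p :=
      differentiableAt_fst.prodMk (hd.differentiableAt.comp p differentiableAt_snd)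
    exact (DifferentiableAt.comp p (hyd p.1 (Ξ.symm p.2) (hneg hp.1)) h1).differentiableWithinAt
  · have h1 : StrictMono Ξ.symm := fun s s' h =>
      (hmono 0 le_rfl).lt_iff_lt.1 (by rwa [hΞs, hΞs])
    exact (hmono t ht).comp h1
  · obtain ⟨Φ, hΦ⟩ := hdiffeo t ht
    exact ⟨Ξ.symm.trans Φ, fun s => hΦ _⟩
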